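/- Let $n,j,k\in\mathbb N$ with $n\ge 1$ and $1\le j<k$. A Young function is a (strictly) increasing convex function $A:[0,\infty)\to[0,\infty)$ with $\lim_{t\to\infty}A(t)/t=\infty$ and $\lim_{t\to0+}A(t)/t=0$; it is a bijection of $[0,\infty)$ and $A^{-1}$ denotes its inverse. For a measurable function $f$ (scalar or vector valued, $|\cdot|$ being the Euclidean norm) on $\mathbb R^n$ or on $(0,\infty)$ with Lebesgue measure, put $$\|f\|_{L^A}=\inf\Big\{\lambda>0:\int A(|f|/\lambda)\,dx\le 1\Big\}\in[0,\infty],\qquad \inf\emptyset=\infty,\quad A(\infty)=\infty .$$ For $f$ on $\mathbb R^n$ and $t>0$ let $f^*(t)=\inf\{s>0:|\{|f|>s\}|\le t\}$ and $f^{**}(t)=\frac1t\int_0^t f^*(s)\,ds$; the norm $\|f^{**}\|_{L^A}$ is taken over $(0,\infty)$. The upper Boyd index of $L^A$ is $\inf_{s>1}\frac{\log h_A(s)}{\log s}$, where $h_A(s)$ is the norm of the dilation operator $f\mapsto f(\cdot/s)$ on $L^A(0,\infty)$. A function $u:\mathbb R^n\to\mathbb R$ is $k$-times weakly differentiable if $u$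 is locally integrable and has locally integrable weak partial derivatives of all orders up to $k$; $\nabla^m u$ is the vector of all weak partial derivatives $\partial_{\alpha_1}\cdots\partial_{\alpha_m}u$, $1\le\alpha_i\le n$. Let $A,B,C$ be Young functions and consider the condition that there is a constant $K$ with $$B^{-1}(t)^{j/k}\,C^{-1}(t)^{1-j/k}\le K\,A^{-1}(t)\qquad\text{for all } t>0. \tag{1}$$ (a) If (1) holds, then there is a constant $K'$ such that $$\|\nabla^j u\|_{L^A}\le K'\,\|(\nabla^k u)^{**}\|_{L^B}^{j/k}\,\|u^{**}\|_{L^C}^{1-j/k}$$ for all $k$-times weakly differentiable functions $u$ on $\mathbb R^n$ for which the right-hand side is not of the indeterminate form $0^{j/k}\cdot\infty^{1-j/k}$. (b) If (1) holds and the upper Boyd indices of $L^B$ and $L^C$ are smaller than $1$, then there is a constant $K'$ such that $$\|\nabla^j u\|_{L^A}\le K'\,\|\nabla^k u\|_{L^B}^{j/k}\,\|u\|_{L^C}^{1-j/k} \tag{2}$$ for all $k$-times weakly differentiable functions $u$ on $\mathbb R^n$ for which the right-hand side is not of the indeterminate form $0^{j/k}\cdot\infty^{1-j/k}$. (c) If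 (1) does not hold, then (2) fails: there is no constant $K'$ for which (2) holds for all $u$ as in (b). -/

import Mathlib

open MeasureTheory Filter Set
open scoped NNReal ENNReal Topology ContDiff

noncomputable section

namespace GNOrlicz

/-! ### Young functions and Orlicz spaces -/

/-- Young functions `A : [0, ∞) → [0, ∞)`: increasing, convex, with `A t / t → ∞` as `t → ∞`
and `A t / t → 0` as `t → 0+`. -/
structure IsYoung (A : ℝ≥0 → ℝ≥0) : Prop where
  strictMono : StrictMono A
  convex : ConvexOn ℝ≥0 univ A
  tendsto_atTop : Tendsto (fun t => A t / t) atTop atTop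
  tendsto_zero : Tendsto (fun t => A t / t) (𝓝[>] 0) (𝓝 0)

theorem IsYoung.bijective {A : ℝ≥0 → ℝ≥0} (hA : IsYoung A) : Function.Bijective A := by
  refine ⟨hA.strictMono.injective, ?_⟩
  have hg : ConvexOn ℝ univ (fun x : ℝ => (A x.toNNReal : ℝ)) := by
    refine ⟨convex_univ, fun x _ y _ a b ha hb hab => ?_⟩
    lift a to ℝ≥0 using ha
    lift b to ℝ≥0 using hb
    have h1 : ((a : ℝ) • x + (b : ℝ) • y).toNNReal ≤ a • x.toNNReal + b • y.toNNReal := by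
      rw [Real.toNNReal_le_iff_le_coe]
      simp only [smul_eq_mul, NNReal.coe_add, NNReal.coe_mul]
      gcongr
      · exact Real.le_coe_toNNReal x
      · exact Real.le_coe_toNNReal y
    have h2 := hA.convex.2 (mem_univ x.toNNReal) (mem_univ y.toNNReal) zero_le zero_le
      (by exact_mod_cast hab)
    exact_mod_cast (hA.strictMono.monotone h1).trans h2
  have hc : Continuous A := by
    have h := (continuousOn_univ.1 (hg.continuousOn isOpen_univ)).comp NNReal.continuous_coe
    simp only [Function.comp_def, Real.toNNReal_coe] at h
    exact NNReal.isEmbedding_coe.continuous_iff.2 h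
  have h0 : A 0 = 0 := by
    have hl : Tendsto (fun t => A t / t * t) (𝓝[>] 0) (𝓝 (0 * 0)) :=
      hA.tendsto_zero.mul (tendsto_id.mono_left nhdsWithin_le_nhds)
    rw [mul_zero] at hl
    refine le_antisymm (ge_of_tendsto hl ?_) zero_le
    filter_upwards [self_mem_nhdsWithin] with t ht
    rw [div_mul_cancel₀ _ (ne_of_gt ht)]
    exact hA.strictMono.monotone zero_le
  intro y
  have htop : Tendsto A atTop atTop := by
    refine tendsto_atTop_mono' _ ?_ hA.tendsto_atTop
    filter_upwards [eventually_ge_atTop 1] with t ht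
    exact div_le_self zero_le ht
  obtain ⟨M, hM⟩ := (htop.eventually_ge_atTop y).exists
  obtain ⟨x, -, hx⟩ := intermediate_value_Icc zero_le hc.continuousOn ⟨by rw [h0]; exact zero_le, hM⟩
  exact ⟨x, hx⟩

/-- The inverse function of `A`. A Young function is a bijection of `[0, ∞)`
(see `IsYoung.bijective`), so this is its two-sided inverse. -/
def inverse (A : ℝ≥0 → ℝ≥0) : ℝ≥0 → ℝ≥0 := Function.invFun A

/-- The extension of `A` to `[0, ∞]` by `A ∞ = ∞`. -/
def extend (A : ℝ≥0 → ℝ≥0) (x : ℝ≥0∞) : ℝ≥0∞ :=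
  if x = ⊤ then ⊤ else (A x.toNNReal : ℝ≥0∞)

/-- The modular `∫ A (f x) dμ(x)` of a `[0, ∞]`-valued function. -/
def modular {α : Type*} [MeasurableSpace α] (A : ℝ≥0 → ℝ≥0) (μ : Measure α)
    (f : α → ℝ≥0∞) : ℝ≥0∞ :=
  ∫⁻ x, extend A (f x) ∂μ

/-- The Luxemburg norm `inf {l > 0 : ∫ A (f / l) dμ ≤ 1}` of a `[0, ∞]`-valued function,
with `inf ∅ = ∞`. For a real or vector valued function apply it to `x ↦ ‖f x‖ₑ`. -/
def luxemburg {α : Type*} [MeasurableSpace α] (A : ℝ≥0 → ℝ≥0) (μ : Measure α)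
    (f : α → ℝ≥0∞) : ℝ≥0∞ :=
  ⨅ (l : ℝ≥0) (_ : 0 < l ∧ modular A μ (fun x => f x / (l : ℝ≥0∞)) ≤ 1), (l : ℝ≥0∞)

/-! ### Rearrangements -/

/-- The non-increasing rearrangement `f* (t) = inf {s ∈ (0, ∞) : μ {f > s} ≤ t}`,
with `inf ∅ = ∞`. -/
def rearr {α : Type*} [MeasurableSpace α] (μ : Measure α) (f : α → ℝ≥0∞) (t : ℝ) : ℝ≥0∞ :=
  ⨅ (s : ℝ≥0) (_ : 0 < s ∧ μ {x | (s : ℝ≥0∞) < f x} ≤ ENNReal.ofReal t), (s : ℝ≥0∞)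

/-- The maximal function of the rearrangement, `f** (t) = (1 / t) ∫₀ᵗ f* (s) ds`, for `t > 0`. -/
def maxRearr {α : Type*} [MeasurableSpace α] (μ : Measure α) (f : α → ℝ≥0∞) (t : ℝ) : ℝ≥0∞ :=
  (∫⁻ s in Ioo 0 t, rearr μ f s) / ENNReal.ofReal t

/-- Lebesgue measure on the half line `(0, ∞)`. -/
abbrev halfLine : Measure ℝ := volume.restrict (Ioi 0)

/-! ### Boyd indices -/

/-- The norm of the dilation operator `f ↦ f (· / s)` on the Orlicz space `L^A (0, ∞)`. -/
def dilationNorm (A : ℝ≥0 → ℝ≥0) (s : ℝ) : ℝ≥0∞ :=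
  ⨆ (f : ℝ → ℝ) (_ : AEMeasurable f halfLine ∧ luxemburg A halfLine (fun t => ‖f t‖ₑ) ≤ 1),
    luxemburg A halfLine (fun t => ‖f (t / s)‖ₑ)

/-- The upper Boyd index `inf_{s > 1} log h (s) / log s` of `L^A`, where `h (s)` is the norm of
the dilation `f ↦ f (· / s)`. For a Young function `1 ≤ h (s) ≤ s` when `s > 1`, so the infimum
is that of a set of numbers in `[0, 1]`. -/
def upperBoydIndex (A : ℝ≥0 → ℝ≥0) : ℝ :=
  ⨅ s : Ioi (1 : ℝ), Real.log (dilationNorm A s).toReal / Real.log s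

/-! ### Weak derivatives -/

/-- `v` is the weak gradient `∇ᵐ u` of order `m` of `u : ℝⁿ → ℝ`: it is locally integrable and its
component with index `(α₁, …, α_m)` is the weak partial derivative `∂_{α₁} ⋯ ∂_{α_m} u`. All these
components together form a vector, measured in the Euclidean norm. -/
def HasWeakGrad {n : ℕ} (m : ℕ) (u : EuclideanSpace ℝ (Fin n) → ℝ)
    (v : EuclideanSpace ℝ (Fin n) → EuclideanSpace ℝ (Fin m → Fin n)) : Prop :=
  LocallyIntegrable v volume ∧
    ∀ φ : EuclideanSpace ℝ (Fin n) → ℝ, ContDiff ℝ ∞ φ → HasCompactSupport φ →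
      ∀ α : Fin m → Fin n,
        ∫ x, u x * iteratedFDeriv ℝ m φ x (fun i => EuclideanSpace.single (α i) (1 : ℝ))
          = (-1) ^ m * ∫ x, v x α * φ x

/-- `u` is `k`-times weakly differentiable on `ℝⁿ`: it is locally integrable and has weak
gradients of all orders up to `k`. -/
def WeaklyDifferentiable {n : ℕ} (k : ℕ) (u : EuclideanSpace ℝ (Fin n) → ℝ) : Prop :=
  LocallyIntegrable u volume ∧ ∀ m ≤ k, ∃ v, HasWeakGrad m u v

/-! ### The condition and the inequalities -/

/-- `B⁻¹(t)^{j/k} C⁻¹(t)^{1-j/k} ≲ A⁻¹(t)` for all `t > 0`. -/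
def InverseCondition (j k : ℕ) (A B C : ℝ≥0 → ℝ≥0) : Prop :=
  ∃ K : ℝ≥0, ∀ t : ℝ≥0, 0 < t →
    inverse B t ^ ((j : ℝ) / k) * inverse C t ^ (1 - (j : ℝ) / k) ≤ K * inverse A t

/-- `‖∇ʲ u‖_{L^A} ≲ ‖(∇ᵏ u)**‖_{L^B}^{j/k} ‖u**‖_{L^C}^{1-j/k}` for all `k`-times weakly
differentiable `u` on `ℝⁿ` whose right-hand side is not the indeterminate `0 · ∞`. -/
def MaximalInequality (n j k : ℕ) (A B C : ℝ≥0 → ℝ≥0) : Prop :=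
  ∃ K : ℝ≥0, ∀ u : EuclideanSpace ℝ (Fin n) → ℝ, WeaklyDifferentiable k u →
    ∀ gj gk, HasWeakGrad j u gj → HasWeakGrad k u gk →
      (luxemburg B halfLine (maxRearr volume fun x => ‖gk x‖ₑ) ≠ 0 ∨
        luxemburg C halfLine (maxRearr volume fun x => ‖u x‖ₑ) ≠ ⊤) →
      luxemburg A volume (fun x => ‖gj x‖ₑ) ≤
        K * (luxemburg B halfLine (maxRearr volume fun x => ‖gk x‖ₑ) ^ ((j : ℝ) / k) *
          luxemburg C halfLine (maxRearr volume fun x => ‖u x‖ₑ) ^ (1 - (j : ℝ) / k))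

/-- `‖∇ʲ u‖_{L^A} ≲ ‖∇ᵏ u‖_{L^B}^{j/k} ‖u‖_{L^C}^{1-j/k}` for all `k`-times weakly
differentiable `u` on `ℝⁿ` whose right-hand side is not the indeterminate `0 · ∞`. -/
def PlainInequality (n j k : ℕ) (A B C : ℝ≥0 → ℝ≥0) : Prop :=
  ∃ K : ℝ≥0, ∀ u : EuclideanSpace ℝ (Fin n) → ℝ, WeaklyDifferentiable k u →
    ∀ gj gk, HasWeakGrad j u gj → HasWeakGrad k u gk →
      (luxemburg B volume (fun x => ‖gk x‖ₑ) ≠ 0 ∨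
        luxemburg C volume (fun x => ‖u x‖ₑ) ≠ ⊤) →
      luxemburg A volume (fun x => ‖gj x‖ₑ) ≤
        K * (luxemburg B volume (fun x => ‖gk x‖ₑ) ^ ((j : ℝ) / k) *
          luxemburg C volume (fun x => ‖u x‖ₑ) ^ (1 - (j : ℝ) / k))

end GNOrlicz

end

/-!
Mollification and finite differences, averaged over balls, give the pointwise bound
`|∇ʲu| ≲ h⁻ʲ Mu + h^(k-j) M|∇ᵏu|` for all `h > 0`, where `M` is the Hardy–Littlewood maximal
operator. With the optimal `h`, condition (1) turns it into
`A(|∇ʲu| / Λ) ≤ B(M|∇ᵏu| / β) + C(Mu / γ)` for `Λ ≈ β^(j/k) γ^(1-j/k)`, and integration bounds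
`‖∇ʲu‖_A` by `‖M|∇ᵏu|‖_B^(j/k) ‖Mu‖_C^(1-j/k)`. For (a), the weak-type (1,1) inequality for `M`
yields `‖Mf‖_B ≲ ‖f**‖_B`. For (b), an upper Boyd index below `1` forces `s B(t) ≤ B(a t)` for some
`a < s`, which makes `M` bounded on `L^B`. For (c), the inequality (2) for the dilates
`x ↦ w(t^(1/n) x)` of a bump function `w` is condition (1) at `t`.
-/

noncomputable section

namespace GNOrlicz

open Metric

/-! ### Maximal functions -/

section Maximal

variable {X : Type*} [PseudoMetricSpace X] [MeasurableSpace X] {μ : Measure X}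
  {f g : X → ℝ≥0∞} {x : X}

/-- The uncentered Hardy–Littlewood maximal function: the supremum of the averages of `f` over the
open balls that contain the point. It takes `[0, ∞]`-valued functions; for a real or vector valued
function apply it to `x ↦ ‖f x‖ₑ`. -/
def maximal (μ : Measure X) (f : X → ℝ≥0∞) (x : X) : ℝ≥0∞ :=
  ⨆ (c : X) (r : ℝ) (_ : x ∈ ball c r), ⨍⁻ y in ball c r, f y ∂μ

theorem laverage_ball_le_maximal {c : X} {r : ℝ} (hx : x ∈ ball c r) :
    ⨍⁻ y in ball c r, f y ∂μ ≤ maximal μ f x :=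
  le_iSup₂_of_le c r (le_iSup_of_le hx le_rfl)

theorem lt_maximal_iff {s : ℝ≥0∞} :
    s < maximal μ f x ↔ ∃ c r, x ∈ ball c r ∧ s < ⨍⁻ y in ball c r, f y ∂μ := by
  simp only [maximal, lt_iSup_iff, exists_prop]

theorem measurable_maximal [OpensMeasurableSpace X] (μ : Measure X) (f : X → ℝ≥0∞) :
    Measurable (maximal μ f) := by
  refine measurable_of_Ioi fun s => IsOpen.measurableSet ?_
  have hunion : maximal μ f ⁻¹' Ioi s =
      ⋃ (c : X) (r : ℝ) (_ : s < ⨍⁻ y in ball c r, f y ∂μ), ball c r := by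
    ext x
    simp only [mem_preimage, mem_Ioi, lt_maximal_iff, mem_iUnion, exists_prop, and_comm]
  rw [hunion]
  exact isOpen_iUnion fun c => isOpen_iUnion fun r => isOpen_iUnion fun _ => isOpen_ball

theorem maximal_mono (h : f ≤ g) : maximal μ f ≤ maximal μ g := fun _ =>
  iSup_mono fun _ => iSup_mono fun _ => iSup_mono fun _ => laverage_mono_ae (.of_forall h)

theorem maximal_const_mul {c : ℝ≥0∞} (hc : c ≠ ⊤) :
    maximal μ (fun y => c * f y) x = c * maximal μ f x := by
  simp only [maximal, laverage, lintegral_const_mul' _ _ hc, ENNReal.mul_iSup]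

theorem maximal_add_const_le (c : ℝ≥0∞) :
    maximal μ (fun y => f y + c) x ≤ maximal μ f x + c := by
  refine iSup_le fun a => iSup₂_le fun r hx => ?_
  have hconst : ⨍⁻ _ in ball a r, c ∂μ ≤ c := by
    rw [laverage, lintegral_const]
    refine mul_le_of_le_one_right' ?_
    simp [ENNReal.inv_mul_le_one]
  calc ⨍⁻ y in ball a r, (f y + c) ∂μ
      = (⨍⁻ y in ball a r, f y ∂μ) + ⨍⁻ _ in ball a r, c ∂μ :=
        lintegral_add_right _ measurable_const
    _ ≤ maximal μ f x + c := add_le_add (laverage_ball_le_maximal hx) hconst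

variable [ProperSpace X] [IsFiniteMeasureOnCompacts μ]

theorem setLIntegral_ball_le_maximal {c : X} {r : ℝ} (hx : x ∈ ball c r) :
    ∫⁻ y in ball c r, f y ∂μ ≤ μ (ball c r) * maximal μ f x := by
  rw [← measure_mul_setLAverage f measure_ball_lt_top.ne]
  gcongr
  exact laverage_ball_le_maximal hx

theorem ae_eq_zero_of_maximal_eq_zero (hf : AEMeasurable f μ) (h : maximal μ f x = 0) :
    f =ᵐ[μ] 0 := by
  have hball : ∀ N : ℕ, f =ᵐ[μ.restrict (ball x (N + 1))] 0 := fun N =>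
    (lintegral_eq_zero_iff' hf.restrict).1 <| le_antisymm
      ((setLIntegral_ball_le_maximal (mem_ball_self N.cast_add_one_pos)).trans (by simp [h]))
      zero_le
  have hcover : ⋃ N : ℕ, ball x ((N : ℝ) + 1) = univ := iUnion_eq_univ_iff.2 fun y => by
    obtain ⟨N, hN⟩ := exists_nat_gt (dist y x)
    exact ⟨N, hN.trans (lt_add_one _)⟩
  rw [← Measure.restrict_univ (μ := μ), ← hcover]
  exact (ae_restrict_iUnion_iff _ _).2 hball

end Maximal

section WeakType

theorem exists_countable_disjoint_balls {ι X : Type*} [PseudoMetricSpace X]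
    [SecondCountableTopology X] {t : Set ι} {c : ι → X} {r : ι → ℝ} (hpos : ∀ i ∈ t, 0 < r i)
    {R : ℝ} (hR : ∀ i ∈ t, r i ≤ R) :
    ∃ w ⊆ t, w.Countable ∧ w.PairwiseDisjoint (fun i => ball (c i) (r i)) ∧
      ⋃ i ∈ t, ball (c i) (r i) ⊆ ⋃ i ∈ w, closedBall (c i) (5 * r i) := by
  obtain ⟨w, hwt, hdisj, hcov⟩ := Vitali.exists_disjoint_subfamily_covering_enlargement_closedBall
    t c r R hR 5 (by norm_num)
  have hdisj' : w.PairwiseDisjoint fun i => ball (c i) (r i) :=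
    hdisj.mono fun i => ball_subset_closedBall
  refine ⟨w, hwt, hdisj'.countable_of_isOpen (fun _ _ => isOpen_ball)
    (fun i hi => nonempty_ball.2 (hpos i (hwt hi))), hdisj', iUnion₂_subset fun i hi => ?_⟩
  obtain ⟨l, hl, hil⟩ := hcov i hi
  exact ball_subset_closedBall.trans (hil.trans (subset_biUnion_of_mem (u := fun i =>
    closedBall (c i) (5 * r i)) hl))

variable {E : Type*} [NormedAddCommGroup E] [NormedSpace ℝ E] [FiniteDimensional ℝ E]
  [MeasurableSpace E] [BorelSpace E]

theorem addHaar_closedBall_mul_eq_mul_ball (μ : Measure E) [μ.IsAddHaarMeasure] (x : E)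
    {a r : ℝ} (ha : 0 ≤ a) (hr : 0 < r) :
    μ (closedBall x (a * r)) = ENNReal.ofReal a ^ Module.finrank ℝ E * μ (ball x r) := by
  rw [Measure.addHaar_closedBall _ _ (by positivity), Measure.addHaar_ball_of_pos _ _ hr, mul_pow,
    ENNReal.ofReal_mul (by positivity), ENNReal.ofReal_pow ha, mul_assoc]

variable [Nontrivial E]

theorem exists_radius_le_of_measure_ball_le (μ : Measure E) [μ.IsAddHaarMeasure] {D : ℝ≥0∞}
    (hD : D ≠ ⊤) : ∃ R : ℝ, ∀ (x : E) (r : ℝ), μ (ball x r) ≤ D → r ≤ R := by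
  have := NormedSpace.noncompactSpace ℝ E
  have hlim : Tendsto (fun N : ℕ => μ (ball (0 : E) N)) atTop (𝓝 ⊤) := by
    rw [← measure_univ_of_isAddLeftInvariant μ, ← iUnion_ball_nat (0 : E)]
    exact tendsto_measure_iUnion_atTop fun a b hab => ball_subset_ball (by exact_mod_cast hab)
  obtain ⟨N, hN⟩ := (hlim.eventually (lt_mem_nhds hD.lt_top)).exists
  refine ⟨N, fun x r hr => not_lt.1 fun hNr => hr.not_gt (hN.trans_le ?_)⟩
  rw [Measure.addHaar_ball_center μ x]
  exact measure_mono (ball_subset_ball hNr.le)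

variable {μ : Measure E} [μ.IsAddHaarMeasure] {f : E → ℝ≥0∞} {s : ℝ≥0∞}

theorem measure_lt_maximal_le (hs : s ≠ 0) (hs' : s ≠ ⊤) :
    μ {x | s < maximal μ f x} ≤ 5 ^ Module.finrank ℝ E * ((∫⁻ x, f x ∂μ) / s) := by
  by_cases hf : ∫⁻ x, f x ∂μ = ⊤
  · simp [hf, ENNReal.top_div_of_ne_top hs', ENNReal.mul_top]
  let t : Set (E × ℝ) := {p | 0 < p.2 ∧ s < ⨍⁻ y in ball p.1 p.2, f y ∂μ}
  have hmeas : ∀ p ∈ t, μ (ball p.1 p.2) ≤ (∫⁻ y in ball p.1 p.2, f y ∂μ) / s := by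
    rintro p ⟨-, hps⟩
    rw [ENNReal.le_div_iff_mul_le (.inl hs) (.inl hs'),
      ← measure_mul_setLAverage f measure_ball_lt_top.ne]
    gcongr
  obtain ⟨R, hR⟩ := exists_radius_le_of_measure_ball_le μ (ENNReal.div_ne_top hf hs)
  obtain ⟨w, hwt, hcount, hdisj, hcov⟩ := exists_countable_disjoint_balls (t := t)
    (c := Prod.fst) (r := Prod.snd) (fun p hp => hp.1) fun p hp => hR p.1 p.2
      ((hmeas p hp).trans (ENNReal.div_le_div_right (setLIntegral_le_lintegral _ _) s))
  have hsub : {x | s < maximal μ f x} ⊆ ⋃ p ∈ w, closedBall p.1 (5 * p.2) := by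
    intro x hx
    obtain ⟨c, r, hxr, hr⟩ := lt_maximal_iff.1 hx
    exact hcov (mem_biUnion (x := (c, r)) ⟨pos_of_mem_ball hxr, hr⟩ hxr)
  have := hcount.to_subtype
  have henlarge : ∀ p : w, μ (closedBall p.1.1 (5 * p.1.2)) ≤
      5 ^ Module.finrank ℝ E * ((∫⁻ y in ball p.1.1 p.1.2, f y ∂μ) / s) := fun p => by
    rw [addHaar_closedBall_mul_eq_mul_ball μ _ (by norm_num) (hwt p.2).1, ENNReal.ofReal_ofNat]
    gcongr
    exact hmeas p.1 (hwt p.2)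
  calc μ {x | s < maximal μ f x} ≤ μ (⋃ p ∈ w, closedBall p.1 (5 * p.2)) := measure_mono hsub
    _ ≤ ∑' p : w, μ (closedBall p.1.1 (5 * p.1.2)) := measure_biUnion_le _ hcount _
    _ ≤ ∑' p : w, 5 ^ Module.finrank ℝ E * ((∫⁻ y in ball p.1.1 p.1.2, f y ∂μ) / s) :=
        ENNReal.tsum_le_tsum henlarge
    _ = 5 ^ Module.finrank ℝ E * ((∫⁻ y in ⋃ p ∈ w, ball p.1 p.2, f y ∂μ) / s) := by
        rw [lintegral_biUnion hcount (fun _ _ => measurableSet_ball) hdisj]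
        simp only [div_eq_mul_inv, ENNReal.tsum_mul_left, ENNReal.tsum_mul_right]
    _ ≤ 5 ^ Module.finrank ℝ E * ((∫⁻ x, f x ∂μ) / s) := by
        gcongr
        exact Measure.restrict_le_self

theorem measure_two_mul_lt_maximal_le (hf : AEMeasurable f μ) (hs : s ≠ 0) (hs' : s ≠ ⊤) :
    μ {x | 2 * s < maximal μ f x} ≤
      5 ^ Module.finrank ℝ E * ((∫⁻ x in {x | s < f x}, f x ∂μ) / s) := by
  rw [← lintegral_indicator₀ (nullMeasurableSet_lt aemeasurable_const hf)]
  refine le_trans (measure_mono fun x (hx : 2 * s < maximal μ f x) => ?_)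
    (measure_lt_maximal_le hs hs')
  have hsplit : f ≤ fun y => {y | s < f y}.indicator f y + s := fun y => by
    by_cases hy : s < f y
    · simp [indicator_of_mem (show y ∈ {y | s < f y} from hy)]
    · exact (not_lt.1 hy).trans le_add_self
  have hle : 2 * s < maximal μ ({y | s < f y}.indicator f) x + s :=
    hx.trans_le ((maximal_mono hsplit x).trans (maximal_add_const_le s))
  rw [two_mul] at hle
  exact lt_of_add_lt_add_right hle

end WeakType

/-! ### Luxemburg norms -/

namespace IsYoung

variable {A : ℝ≥0 → ℝ≥0}

theorem map_inverse (hA : IsYoung A) (t : ℝ≥0) : A (inverse A t) = t :=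
  Function.rightInverse_invFun hA.bijective.2 t

theorem inverse_map (hA : IsYoung A) (t : ℝ≥0) : inverse A (A t) = t :=
  Function.leftInverse_invFun hA.bijective.1 t

theorem map_zero (hA : IsYoung A) : A 0 = 0 := by
  obtain ⟨t, ht⟩ := hA.bijective.2 0
  exact le_antisymm ((hA.strictMono.monotone zero_le).trans ht.le) zero_le

theorem map_pos (hA : IsYoung A) {t : ℝ≥0} (ht : 0 < t) : 0 < A t :=
  hA.map_zero ▸ hA.strictMono ht

theorem le_inverse_iff (hA : IsYoung A) {s t : ℝ≥0} : s ≤ inverse A t ↔ A s ≤ t := by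
  rw [← hA.strictMono.le_iff_le, hA.map_inverse]

theorem inverse_pos (hA : IsYoung A) {t : ℝ≥0} (ht : 0 < t) : 0 < inverse A t := by
  rwa [← hA.strictMono.lt_iff_lt, hA.map_inverse, hA.map_zero]

theorem map_mul_le (hA : IsYoung A) {c : ℝ≥0} (hc : c ≤ 1) (t : ℝ≥0) : A (c * t) ≤ c * A t := by
  simpa [hA.map_zero] using
    hA.convex.2 (mem_univ t) (mem_univ 0) zero_le zero_le (add_tsub_cancel_of_le hc)

theorem inverse_mul_le (hA : IsYoung A) {c : ℝ≥0} (hc : 1 ≤ c) (t : ℝ≥0) :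
    inverse A (c * t) ≤ c * inverse A t := by
  have hc0 : 0 < c := zero_lt_one.trans_le hc
  rw [← inv_mul_le_iff₀ hc0, hA.le_inverse_iff]
  calc A (c⁻¹ * inverse A (c * t)) ≤ c⁻¹ * A (inverse A (c * t)) :=
        hA.map_mul_le (inv_le_one_of_one_le₀ hc) _
    _ = t := by rw [hA.map_inverse, inv_mul_cancel_left₀ hc0.ne']

end IsYoung

@[simp]
theorem extend_coe (A : ℝ≥0 → ℝ≥0) (t : ℝ≥0) : extend A t = A t := by simp [extend]

@[simp]
theorem extend_top (A : ℝ≥0 → ℝ≥0) : extend A ⊤ = ⊤ := by simp [extend]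

namespace IsYoung

variable {A : ℝ≥0 → ℝ≥0}

theorem extend_le_coe_iff (hA : IsYoung A) {x : ℝ≥0∞} {t : ℝ≥0} :
    extend A x ≤ t ↔ x ≤ inverse A t := by
  induction x with
  | top => simp
  | coe x => rw [extend_coe, ENNReal.coe_le_coe, ENNReal.coe_le_coe, hA.le_inverse_iff]

theorem coe_lt_extend_iff (hA : IsYoung A) {x : ℝ≥0∞} {t : ℝ≥0} :
    (t : ℝ≥0∞) < extend A x ↔ (inverse A t : ℝ≥0∞) < x := by
  rw [← not_le, hA.extend_le_coe_iff, not_le]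

theorem extend_mono (hA : IsYoung A) : Monotone (extend A) := by
  intro x y hxy
  induction y with
  | top => simp
  | coe y =>
    rw [extend_coe, hA.extend_le_coe_iff, hA.inverse_map]
    exact hxy

theorem measurable_extend (hA : IsYoung A) : Measurable (extend A) := hA.extend_mono.measurable

theorem extend_zero (hA : IsYoung A) : extend A 0 = 0 := by
  simpa [hA.map_zero] using extend_coe A 0

theorem extend_eq_zero (hA : IsYoung A) {x : ℝ≥0∞} (h : extend A x = 0) : x = 0 := by
  have hx := hA.extend_le_coe_iff (t := 0).1 h.le
  rw [← hA.map_zero, hA.inverse_map] at hx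
  simpa using hx

theorem extend_mul_le (hA : IsYoung A) {c : ℝ≥0} (hc : c ≤ 1) (x : ℝ≥0∞) :
    extend A (c * x) ≤ c * extend A x := by
  rcases eq_or_ne c 0 with rfl | hc0
  · simp [hA.extend_zero]
  induction x with
  | top => simp [ENNReal.mul_top, hc0]
  | coe x =>
    rw [← ENNReal.coe_mul, extend_coe, extend_coe, ← ENNReal.coe_mul]
    exact_mod_cast hA.map_mul_le hc x

end IsYoung

section Luxemburg

variable {α β : Type*} [MeasurableSpace α] [MeasurableSpace β] {A B : ℝ≥0 → ℝ≥0}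
  {μ : Measure α} {ν : Measure β} {f g : α → ℝ≥0∞}

theorem luxemburg_le {l : ℝ≥0} (hl : 0 < l)
    (h : modular A μ (fun x => f x / (l : ℝ≥0∞)) ≤ 1) : luxemburg A μ f ≤ l :=
  iInf₂_le l ⟨hl, h⟩

namespace IsYoung

theorem modular_mono (hA : IsYoung A) (h : f ≤ g) : modular A μ f ≤ modular A μ g :=
  lintegral_mono fun x => hA.extend_mono (h x)

theorem modular_mul_le (hA : IsYoung A) {c : ℝ≥0} (hc : c ≤ 1) :
    modular A μ (fun x => c * f x) ≤ c * modular A μ f := by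
  rw [modular, modular, ← lintegral_const_mul' _ _ ENNReal.coe_ne_top]
  exact lintegral_mono fun x => hA.extend_mul_le hc (f x)

theorem luxemburg_mono (hA : IsYoung A) (h : f ≤ g) : luxemburg A μ f ≤ luxemburg A μ g :=
  iInf_mono fun _ => iInf_mono' fun hl => ⟨⟨hl.1, (hA.modular_mono fun x =>
    ENNReal.div_le_div_right (h x) _).trans hl.2⟩, le_rfl⟩

theorem modular_le_one_of_luxemburg_lt (hA : IsYoung A) {l : ℝ≥0}
    (h : luxemburg A μ f < l) : modular A μ (fun x => f x / (l : ℝ≥0∞)) ≤ 1 := by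
  simp only [luxemburg, iInf_lt_iff] at h
  obtain ⟨l', ⟨-, hl'⟩, hlt⟩ := h
  exact (hA.modular_mono fun x => ENNReal.div_le_div_left hlt.le _).trans hl'

theorem luxemburg_le_of_modular_le (hA : IsYoung A) {l D : ℝ≥0} (hl : 0 < l)
    (hD : 1 ≤ D) (h : modular A μ (fun x => f x / (l : ℝ≥0∞)) ≤ D) :
    luxemburg A μ f ≤ (D * l : ℝ≥0) := by
  have hD0 : 0 < D := zero_lt_one.trans_le hD
  have hrescale : (fun x => f x / ((D * l : ℝ≥0) : ℝ≥0∞)) =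
      fun x => ((D⁻¹ : ℝ≥0) : ℝ≥0∞) * (f x / l) := by
    ext x
    rw [ENNReal.coe_mul, ENNReal.coe_inv hD0.ne', div_eq_mul_inv, ENNReal.mul_inv
      (.inl (by simpa using hD0.ne')) (.inl ENNReal.coe_ne_top), div_eq_mul_inv, mul_left_comm]
  refine luxemburg_le (by positivity) ?_
  calc modular A μ (fun x => f x / ((D * l : ℝ≥0) : ℝ≥0∞))
      ≤ ((D⁻¹ : ℝ≥0) : ℝ≥0∞) * modular A μ (fun x => f x / (l : ℝ≥0∞)) :=
        hrescale ▸ hA.modular_mul_le (inv_le_one_of_one_le₀ hD)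
    _ ≤ ((D⁻¹ : ℝ≥0) : ℝ≥0∞) * D := by gcongr
    _ = 1 := by rw [← ENNReal.coe_mul, inv_mul_cancel₀ hD0.ne', ENNReal.coe_one]

theorem luxemburg_le_mul_luxemburg (hA : IsYoung A) {g : β → ℝ≥0∞} {D p : ℝ≥0}
    (hD : 1 ≤ D) (hp : 0 < p)
    (h : ∀ l : ℝ≥0, 0 < l → modular B ν (fun y => g y / (l : ℝ≥0∞)) ≤ 1 →
      modular A μ (fun x => f x / ((p * l : ℝ≥0) : ℝ≥0∞)) ≤ D) :
    luxemburg A μ f ≤ (D * p : ℝ≥0) * luxemburg B ν g := by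
  have hDp : D * p ≠ 0 := (mul_pos (zero_lt_one.trans_le hD) hp).ne'
  rw [← ENNReal.div_le_iff' (by simpa using hDp) ENNReal.coe_ne_top]
  refine le_iInf₂ fun l hl => ENNReal.div_le_of_le_mul' ?_
  rw [← ENNReal.coe_mul, mul_assoc]
  exact hA.luxemburg_le_of_modular_le (mul_pos hp hl.1) hD (h l hl.1 hl.2)

theorem luxemburg_const_mul_le (hA : IsYoung A) {c : ℝ≥0} (hc : 0 < c) :
    luxemburg A μ (fun x => c * f x) ≤ c * luxemburg A μ f := by
  have hc' : (c : ℝ≥0∞) ≠ 0 := by simpa using hc.ne'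
  simpa using hA.luxemburg_le_mul_luxemburg (A := A) (B := A) le_rfl hc fun l _ hmod => by
    simpa only [ENNReal.coe_mul, ENNReal.mul_div_mul_left _ _ hc' ENNReal.coe_ne_top,
      ENNReal.coe_one] using hmod

theorem luxemburg_const_mul (hA : IsYoung A) {c : ℝ≥0} (hc : 0 < c) :
    luxemburg A μ (fun x => c * f x) = c * luxemburg A μ f := by
  have hc' : (c : ℝ≥0∞) ≠ 0 := by simpa using hc.ne'
  refine le_antisymm (hA.luxemburg_const_mul_le hc) ?_
  have h := hA.luxemburg_const_mul_le (μ := μ) (f := fun x => c * f x) (inv_pos.2 hc)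
  simp only [ENNReal.coe_inv hc.ne', ← mul_assoc,
    ENNReal.inv_mul_cancel hc' ENNReal.coe_ne_top, one_mul] at h
  rwa [← ENNReal.div_eq_inv_mul, ENNReal.le_div_iff_mul_le (.inl hc') (.inl ENNReal.coe_ne_top),
    mul_comm] at h

theorem luxemburg_eq_zero_of_ae_eq_zero (hA : IsYoung A) (h : f =ᵐ[μ] 0) :
    luxemburg A μ f = 0 := by
  have hmod : ∀ l : ℝ≥0, modular A μ (fun x => f x / (l : ℝ≥0∞)) = 0 := fun l => by
    rw [modular, lintegral_congr_ae (g := 0) (h.mono fun x hx => by simp [hx, hA.extend_zero])]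
    exact lintegral_zero
  refine le_antisymm (le_of_forall_gt fun c hc => ?_) zero_le
  obtain ⟨l, hl0, hlc⟩ := ENNReal.lt_iff_exists_nnreal_btwn.1 hc
  exact (luxemburg_le (by exact_mod_cast hl0) (by simp [hmod])).trans_lt hlc

theorem luxemburg_eq_zero_iff (hA : IsYoung A) (hf : AEMeasurable f μ) :
    luxemburg A μ f = 0 ↔ f =ᵐ[μ] 0 := by
  refine ⟨fun h => ?_, hA.luxemburg_eq_zero_of_ae_eq_zero⟩
  have hsmall : ∀ l : ℝ≥0, 0 < l → l ≤ 1 → modular A μ f ≤ l := fun l hl hl1 => by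
    have hl0 : (l : ℝ≥0∞) ≠ 0 := by simpa using hl.ne'
    calc modular A μ f = modular A μ (fun x => l * (f x / l)) := by
          simp only [ENNReal.mul_div_cancel hl0 ENNReal.coe_ne_top]
      _ ≤ l * modular A μ (fun x => f x / l) := hA.modular_mul_le hl1
      _ ≤ l * 1 := by
          gcongr
          exact hA.modular_le_one_of_luxemburg_lt (by simpa [h] using hl)
      _ = l := mul_one _
  have hmod : modular A μ f = 0 := le_antisymm (le_of_forall_gt fun c hc => by
    obtain ⟨l, hl0, hlc⟩ := ENNReal.lt_iff_exists_nnreal_btwn.1 (lt_min hc one_pos)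
    rw [lt_min_iff] at hlc
    exact (hsmall l (by exact_mod_cast hl0) (by exact_mod_cast hlc.2.le)).trans_lt hlc.1) zero_le
  exact ((lintegral_eq_zero_iff' (hA.measurable_extend.comp_aemeasurable hf)).1 hmod).mono
    fun x hx => hA.extend_eq_zero hx

variable {S : Set α} {s t : ℝ≥0}

theorem modular_indicator_div (hA : IsYoung A) (hS : MeasurableSet S) {l : ℝ≥0} (hl : 0 < l) :
    modular A μ (fun x => S.indicator (fun _ => (s : ℝ≥0∞)) x / (l : ℝ≥0∞)) =
      A (s / l) * μ S := by
  rw [← lintegral_indicator_const hS]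
  refine lintegral_congr fun x => ?_
  beta_reduce
  by_cases hx : x ∈ S
  · rw [indicator_of_mem hx, indicator_of_mem hx, ← ENNReal.coe_div hl.ne', extend_coe]
  · simp [indicator_of_notMem hx, hA.extend_zero]

theorem luxemburg_indicator_le (hA : IsYoung A) (hS : MeasurableSet S) (hs : 0 < s) (ht : 0 < t)
    (hμ : μ S * t ≤ 1) :
    luxemburg A μ (S.indicator fun _ => (s : ℝ≥0∞)) ≤ (s / inverse A t : ℝ≥0) := by
  have hl := div_pos hs (hA.inverse_pos ht)
  refine luxemburg_le hl ?_
  rwa [hA.modular_indicator_div hS hl, div_div_cancel₀ hs.ne', hA.map_inverse, mul_comm]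

theorem le_luxemburg_indicator (hA : IsYoung A) (hS : MeasurableSet S) (ht : 0 < t)
    (hμ : 1 ≤ μ S * t) :
    ((s / inverse A t : ℝ≥0) : ℝ≥0∞) ≤ luxemburg A μ (S.indicator fun _ => (s : ℝ≥0∞)) := by
  refine le_iInf₂ fun l ⟨hl, hmod⟩ => ?_
  rw [hA.modular_indicator_div hS hl] at hmod
  have hle : (A (s / l) : ℝ≥0∞) ≤ t := by
    calc (A (s / l) : ℝ≥0∞) ≤ A (s / l) * (μ S * t) := le_mul_of_one_le_right' hμ
      _ = A (s / l) * μ S * t := (mul_assoc _ _ _).symm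
      _ ≤ t := mul_le_of_le_one_left' hmod
  rw [ENNReal.coe_le_coe, ← hA.le_inverse_iff, div_le_iff₀ hl] at hle
  exact_mod_cast (div_le_iff₀' (hA.inverse_pos ht)).2 hle

end IsYoung

end Luxemburg

/-! ### Maximal functions and rearrangements -/

section Distribution

variable {α β : Type*} [MeasurableSpace α] [MeasurableSpace β] {μ : Measure α} {ν : Measure β}

theorem lintegral_min_eq_lintegral_meas_lt {f : α → ℝ≥0∞} (hf : AEMeasurable f μ) (N : ℕ) :
    ∫⁻ x, min (f x) N ∂μ = ∫⁻ t in Ioi (0 : ℝ), μ {x | ENNReal.ofReal t < min (f x) N} := by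
  have hfin : ∀ x, min (f x) N ≠ ⊤ := fun x =>
    ne_top_of_le_ne_top (ENNReal.natCast_ne_top N) (min_le_right _ _)
  have h := lintegral_eq_lintegral_meas_lt (f := fun x => (min (f x) N).toReal) μ
    (.of_forall fun x => ENNReal.toReal_nonneg) (hf.min aemeasurable_const).ennreal_toReal
  simp only [ENNReal.ofReal_toReal (hfin _)] at h
  rw [h]
  refine setLIntegral_congr_fun measurableSet_Ioi fun t ht => ?_
  simp only [ENNReal.ofReal_lt_iff_lt_toReal (le_of_lt ht) (hfin _)]

theorem lintegral_le_of_meas_lt_le {f : α → ℝ≥0∞} {g : β → ℝ≥0∞} (hf : AEMeasurable f μ)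
    (hg : AEMeasurable g ν) {c : ℝ≥0∞} (hc : c ≠ ⊤)
    (h : ∀ r : ℝ≥0, 0 < r → μ {x | (r : ℝ≥0∞) < f x} ≤ c * ν {y | (r : ℝ≥0∞) < g y}) :
    ∫⁻ x, f x ∂μ ≤ c * ∫⁻ y, g y ∂ν := by
  have hsup : ∀ x, f x = ⨆ N : ℕ, min (f x) N := fun x => by
    rw [← inf_iSup_eq, ENNReal.iSup_natCast, inf_top_eq]
  have hmono : ∀ x, Monotone fun N : ℕ => min (f x) N := fun x a b hab =>
    min_le_min_left _ (by exact_mod_cast hab)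
  rw [lintegral_congr hsup, lintegral_iSup' (fun N => hf.min aemeasurable_const)
    (.of_forall hmono)]
  refine iSup_le fun N => ?_
  calc ∫⁻ x, min (f x) N ∂μ
      = ∫⁻ t in Ioi (0 : ℝ), μ {x | ENNReal.ofReal t < min (f x) N} :=
        lintegral_min_eq_lintegral_meas_lt hf N
    _ ≤ ∫⁻ t in Ioi (0 : ℝ), c * ν {y | ENNReal.ofReal t < min (g y) N} := by
        refine setLIntegral_mono' measurableSet_Ioi fun t ht => ?_
        by_cases htN : ENNReal.ofReal t < N
        · simp only [lt_min_iff, htN, and_true]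
          exact h t.toNNReal (Real.toNNReal_pos.2 ht)
        · simp [htN]
    _ = c * ∫⁻ y, min (g y) N ∂ν := by
        rw [lintegral_const_mul' _ _ hc, lintegral_min_eq_lintegral_meas_lt hg N]
    _ ≤ c * ∫⁻ y, g y ∂ν := by
        gcongr
        exact min_le_left _ _

end Distribution

section Rearrangement

variable {α : Type*} [MeasurableSpace α] {μ : Measure α} {f : α → ℝ≥0∞}

theorem rearr_antitone : Antitone (rearr μ f) := fun _ _ hab =>
  le_iInf₂ fun s hs => iInf₂_le s ⟨hs.1, hs.2.trans (ENNReal.ofReal_le_ofReal hab)⟩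

theorem measurable_maxRearr : Measurable (maxRearr μ f) :=
  (Monotone.measurable fun _ _ hab => lintegral_mono_set (Ioo_subset_Ioo_right hab)).div
    ENNReal.measurable_ofReal

theorem measure_lt_le_of_rearr_le {t : ℝ} {r : ℝ≥0} (h : rearr μ f t ≤ r) :
    μ {x | (r : ℝ≥0∞) < f x} ≤ ENNReal.ofReal t := by
  obtain ⟨u, hanti, hru, hlim⟩ := exists_seq_strictAnti_tendsto r
  have hunion : {x | (r : ℝ≥0∞) < f x} = ⋃ i, {x | (u i : ℝ≥0∞) < f x} := by
    ext x
    simp only [mem_ofPred_eq, mem_iUnion]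
    refine ⟨fun hx => ?_, fun ⟨i, hi⟩ => lt_trans (by exact_mod_cast hru i) hi⟩
    exact ((ENNReal.tendsto_coe.2 hlim).eventually (gt_mem_nhds hx)).exists
  have hmono : Monotone fun i => {x | (u i : ℝ≥0∞) < f x} := fun i l hil x hx =>
    lt_of_le_of_lt (by exact_mod_cast hanti.antitone hil) (mem_ofPred_eq ▸ hx)
  rw [hunion, hmono.measure_iUnion]
  refine iSup_le fun i => ?_
  have hlt : rearr μ f t < u i := h.trans_lt (by exact_mod_cast hru i)
  simp only [rearr, iInf_lt_iff] at hlt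
  obtain ⟨s, hs, hsu⟩ := hlt
  exact (measure_mono fun x (hx : (u i : ℝ≥0∞) < f x) => hsu.trans hx).trans hs.2

theorem mul_rearr_le_setLIntegral_rearr (t : ℝ) :
    ENNReal.ofReal t * rearr μ f t ≤ ∫⁻ τ in Ioo 0 t, rearr μ f τ := by
  calc ENNReal.ofReal t * rearr μ f t = ∫⁻ _ in Ioo 0 t, rearr μ f t := by simp [mul_comm]
    _ ≤ _ := setLIntegral_mono' measurableSet_Ioo fun τ hτ => rearr_antitone hτ.2.le

theorem setLIntegral_le_setLIntegral_rearr (hf : AEMeasurable f μ) {S : Set α}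
    (hS : NullMeasurableSet S μ) {t : ℝ} (ht : 0 < t) (hμ : μ S ≤ ENNReal.ofReal t) :
    ∫⁻ x in S, f x ∂μ ≤ ∫⁻ τ in Ioo 0 t, rearr μ f τ := by
  rw [← one_mul (∫⁻ τ in Ioo 0 t, _), ← lintegral_indicator₀ hS]
  refine lintegral_le_of_meas_lt_le (hf.indicator₀ hS) rearr_antitone.measurable.aemeasurable
    ENNReal.one_ne_top fun r _ => ?_
  rw [one_mul, Measure.restrict_apply
    (measurableSet_lt measurable_const rearr_antitone.measurable)]
  let w := min (ENNReal.ofReal t) (μ {x | (r : ℝ≥0∞) < f x})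
  have hw : w ≠ ⊤ := ne_top_of_le_ne_top ENNReal.ofReal_ne_top (min_le_left _ _)
  calc μ {x | (r : ℝ≥0∞) < S.indicator f x} ≤ w := by
        refine le_min ((measure_mono fun x (hx : r < S.indicator f x) => ?_).trans hμ)
          (measure_mono fun x (hx : r < S.indicator f x) =>
            mem_ofPred_eq ▸ hx.trans_le (indicator_le_self _ _ _))
        by_contra hxS
        simp [indicator_of_notMem hxS] at hx
    _ = volume (Ioo 0 w.toReal) := by
        rw [Real.volume_Ioo, sub_zero, ENNReal.ofReal_toReal hw]
    _ ≤ volume ({τ | (r : ℝ≥0∞) < rearr μ f τ} ∩ Ioo 0 t) := by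
        refine measure_mono fun τ hτ => ?_
        have hτw : ENNReal.ofReal τ < w := (ENNReal.ofReal_lt_iff_lt_toReal hτ.1.le hw).2 hτ.2
        refine ⟨mem_ofPred_eq ▸ not_le.1 fun hr => ?_, hτ.1, ?_⟩
        · exact (hτw.trans_le (min_le_right _ _)).not_ge (measure_lt_le_of_rearr_le hr)
        · exact (ENNReal.ofReal_lt_ofReal_iff ht).1 (hτw.trans_le (min_le_left _ _))

theorem setLIntegral_lt_le_of_maxRearr_le (hf : AEMeasurable f μ) {t : ℝ} (ht : 0 < t) {s : ℝ≥0}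
    (h : maxRearr μ f t ≤ s) : ∫⁻ x in {x | (s : ℝ≥0∞) < f x}, f x ∂μ ≤ ENNReal.ofReal t * s := by
  have ht0 : ENNReal.ofReal t ≠ 0 := (ENNReal.ofReal_pos.2 ht).ne'
  have hint : ∫⁻ τ in Ioo 0 t, rearr μ f τ ≤ ENNReal.ofReal t * s := by
    rwa [maxRearr, ENNReal.div_le_iff' ht0 ENNReal.ofReal_ne_top] at h
  have hrearr : rearr μ f t ≤ s := by
    rw [← ENNReal.mul_le_mul_iff_right ht0 ENNReal.ofReal_ne_top]
    exact (mul_rearr_le_setLIntegral_rearr t).trans hint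
  exact (setLIntegral_le_setLIntegral_rearr hf (nullMeasurableSet_lt aemeasurable_const hf) ht
    (measure_lt_le_of_rearr_le hrearr)).trans hint

end Rearrangement

section MaximalRearrangement

variable {E : Type*} [NormedAddCommGroup E] [NormedSpace ℝ E] [FiniteDimensional ℝ E]
  [Nontrivial E] [MeasurableSpace E] [BorelSpace E] {μ : Measure E} [μ.IsAddHaarMeasure]
  {f : E → ℝ≥0∞} {B : ℝ≥0 → ℝ≥0}

theorem measure_two_mul_lt_maximal_le_maxRearr (hf : AEMeasurable f μ) {s : ℝ≥0} (hs : 0 < s) :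
    μ {x | 2 * (s : ℝ≥0∞) < maximal μ f x} ≤
      5 ^ Module.finrank ℝ E * halfLine {t | (s : ℝ≥0∞) < maxRearr μ f t} := by
  have hs0 : (s : ℝ≥0∞) ≠ 0 := by simpa using hs.ne'
  rw [Measure.restrict_apply (measurableSet_lt measurable_const measurable_maxRearr),
    ← ENNReal.div_le_iff' (by positivity) (by simp)]
  refine le_of_forall_gt fun c hc => ?_
  obtain ⟨t, htT, htc⟩ := ENNReal.lt_iff_exists_nnreal_btwn.1 hc
  obtain ⟨τ, hτ0, hτt, hτs⟩ : ∃ τ : ℝ, 0 < τ ∧ τ < t ∧ maxRearr μ f τ ≤ s := by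
    by_contra! hcon
    refine htT.not_ge ?_
    calc (t : ℝ≥0∞) = volume (Ioo (0 : ℝ) t) := by simp
      _ ≤ volume ({t | (s : ℝ≥0∞) < maxRearr μ f t} ∩ Ioi 0) :=
        measure_mono fun τ hτ => ⟨hcon τ hτ.1 hτ.2, hτ.1⟩
  refine lt_of_le_of_lt ?_ htc
  rw [ENNReal.div_le_iff' (by positivity) (by simp)]
  refine (measure_two_mul_lt_maximal_le hf hs0 ENNReal.coe_ne_top).trans ?_
  gcongr
  refine (ENNReal.div_le_of_le_mul (setLIntegral_lt_le_of_maxRearr_le hf hτ0 hτs)).trans ?_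
  exact (ENNReal.ofReal_le_ofReal hτt.le).trans_eq (ENNReal.ofReal_coe_nnreal)

theorem IsYoung.modular_maximal_le_modular_maxRearr (hB : IsYoung B) (hf : AEMeasurable f μ)
    {l : ℝ≥0} (hl : 0 < l) :
    modular B μ (fun x => maximal μ f x / ((2 * l : ℝ≥0) : ℝ≥0∞)) ≤
      5 ^ Module.finrank ℝ E * modular B halfLine (fun t => maxRearr μ f t / (l : ℝ≥0∞)) := by
  have hlt : ∀ {p : ℝ≥0}, 0 < p → ∀ (x : ℝ≥0∞) (r : ℝ≥0),
      (r : ℝ≥0∞) < extend B (x / p) ↔ ((p * inverse B r : ℝ≥0) : ℝ≥0∞) < x := fun hp x r => by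
    rw [hB.coe_lt_extend_iff, ENNReal.lt_div_iff_mul_lt (.inl (by simpa using hp.ne'))
      (.inl ENNReal.coe_ne_top), ENNReal.coe_mul, mul_comm]
  refine lintegral_le_of_meas_lt_le
    (hB.measurable_extend.comp ((measurable_maximal μ f).div_const _)).aemeasurable
    (hB.measurable_extend.comp (measurable_maxRearr.div_const _)).aemeasurable (by simp)
    fun r hr => ?_
  simp only [Function.comp_apply, hlt hl, hlt (mul_pos two_pos hl), mul_assoc]
  exact_mod_cast measure_two_mul_lt_maximal_le_maxRearr hf (mul_pos hl (hB.inverse_pos hr))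

theorem IsYoung.luxemburg_maximal_le_maxRearr (hB : IsYoung B) (hf : AEMeasurable f μ) :
    luxemburg B μ (maximal μ f) ≤
      (5 ^ Module.finrank ℝ E * 2 : ℝ≥0) * luxemburg B halfLine (maxRearr μ f) := by
  refine hB.luxemburg_le_mul_luxemburg (one_le_pow₀ (by norm_num)) two_pos fun l hl hmod => ?_
  calc modular B μ (fun x => maximal μ f x / ((2 * l : ℝ≥0) : ℝ≥0∞))
      ≤ 5 ^ Module.finrank ℝ E * 1 := by
        refine (hB.modular_maximal_le_modular_maxRearr hf hl).trans ?_
        gcongr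
    _ = _ := by simp

end MaximalRearrangement

/-! ### Maximal functions and upper Boyd indices -/

section BoydIndex

variable {B : ℝ≥0 → ℝ≥0} {s a : ℝ≥0}

theorem lintegral_halfLine_comp_div (f : ℝ → ℝ≥0∞) (hs : 0 < s) :
    ∫⁻ t, f (t / s) ∂halfLine = s * ∫⁻ t, f t ∂halfLine := by
  have hs' : (0 : ℝ) < s := by exact_mod_cast hs
  let e : ℝ ≃ᵐ ℝ := (Homeomorph.mulRight₀ (s : ℝ)⁻¹ (inv_ne_zero hs'.ne')).toMeasurableEquiv
  have hmap : Measure.map e volume = (s : ℝ≥0∞) • (volume : Measure ℝ) := by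
    have h := Real.map_volume_mul_right (inv_ne_zero hs'.ne')
    rwa [inv_inv, abs_of_pos hs', ENNReal.ofReal_coe_nnreal] at h
  have hpre : (fun t : ℝ => (Ioi 0).indicator (fun t => f (t / s)) t) =
      fun t => (Ioi 0).indicator f (e t) := by
    ext t
    have he : e t = t / s := rfl
    simp only [indicator_apply, mem_Ioi, he, div_pos_iff_of_pos_right hs']
  rw [← lintegral_indicator measurableSet_Ioi, ← lintegral_indicator measurableSet_Ioi, hpre,
    ← lintegral_map_equiv _ e, hmap, lintegral_smul_measure, smul_eq_mul]

namespace IsYoung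

theorem dilationNorm_le (hB : IsYoung B) (hs : 1 ≤ s) : dilationNorm B s ≤ s := by
  refine iSup₂_le fun f hf => ?_
  have hle : luxemburg B halfLine (fun t => ‖f (t / s)‖ₑ) ≤
      (s * 1 : ℝ≥0) * luxemburg B halfLine (fun t => ‖f t‖ₑ) := by
    refine hB.luxemburg_le_mul_luxemburg hs one_pos fun l _ hmod => ?_
    rw [one_mul, modular, lintegral_halfLine_comp_div (fun t => extend B (‖f t‖ₑ / (l : ℝ≥0∞)))
      (zero_lt_one.trans_le hs)]
    exact mul_le_of_le_one_right' hmod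
  rw [mul_one] at hle
  exact hle.trans (mul_le_of_le_one_right' hf.2)

theorem inverse_div_inverse_le_dilationNorm (hB : IsYoung B) (hs : 0 < s) {r : ℝ≥0} (hr : 0 < r) :
    ((inverse B r / inverse B (r / s) : ℝ≥0) : ℝ≥0∞) ≤ dilationNorm B s := by
  have hs' : (0 : ℝ) < s := by exact_mod_cast hs
  let f : ℝ → ℝ := (Ioo (0 : ℝ) (r⁻¹ : ℝ≥0)).indicator fun _ => (inverse B r : ℝ)
  have hf : (fun τ => ‖f τ‖ₑ) =
      (Ioo (0 : ℝ) (r⁻¹ : ℝ≥0)).indicator fun _ => (inverse B r : ℝ≥0∞) := by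
    ext τ
    simp [f, enorm_indicator_eq_indicator_enorm, Real.enorm_eq_ofReal]
  have hfs : (fun τ => ‖f (τ / s)‖ₑ) =
      (Ioo (0 : ℝ) (s * r⁻¹ : ℝ≥0)).indicator fun _ => (inverse B r : ℝ≥0∞) := by
    ext τ
    rw [congrFun hf (τ / s)]
    simp only [indicator_apply, mem_Ioo, div_pos_iff_of_pos_right hs', div_lt_iff₀' hs',
      NNReal.coe_mul]
  have hvol : ∀ w : ℝ≥0, halfLine (Ioo (0 : ℝ) w) = w := fun w => by
    rw [Measure.restrict_apply measurableSet_Ioo,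
      inter_eq_self_of_subset_left Ioo_subset_Ioi_self, Real.volume_Ioo, sub_zero,
      ENNReal.ofReal_coe_nnreal]
  have hf1 : luxemburg B halfLine (fun τ => ‖f τ‖ₑ) ≤ 1 := by
    rw [hf]
    refine (hB.luxemburg_indicator_le measurableSet_Ioo (hB.inverse_pos hr) hr ?_).trans_eq
      (by rw [div_self (hB.inverse_pos hr).ne', ENNReal.coe_one])
    rw [hvol, ← ENNReal.coe_mul, inv_mul_cancel₀ hr.ne', ENNReal.coe_one]
  calc ((inverse B r / inverse B (r / s) : ℝ≥0) : ℝ≥0∞)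
      ≤ luxemburg B halfLine (fun τ => ‖f (τ / s)‖ₑ) := by
        rw [hfs]
        refine hB.le_luxemburg_indicator measurableSet_Ioo (div_pos hr hs) ?_
        rw [hvol, ← ENNReal.coe_mul, mul_assoc, inv_mul_eq_div, div_div_cancel_left' hr.ne',
          mul_inv_cancel₀ hs.ne', ENNReal.coe_one]
    _ ≤ dilationNorm B s :=
        le_iSup₂_of_le (f := fun (f : ℝ → ℝ) (_ : AEMeasurable f halfLine ∧
          luxemburg B halfLine (fun t => ‖f t‖ₑ) ≤ 1) =>
            luxemburg B halfLine (fun t => ‖f (t / s)‖ₑ)) f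
          ⟨(measurable_const.indicator measurableSet_Ioo).aemeasurable, hf1⟩ le_rfl

theorem exists_dilationNorm_lt_of_upperBoydIndex_lt (hB : IsYoung B) (h : upperBoydIndex B < 1) :
    ∃ s : ℝ≥0, 1 < s ∧ dilationNorm B s < s := by
  obtain ⟨⟨s, hs⟩, hlog⟩ := exists_lt_of_ciInf_lt h
  have hs0 : (0 : ℝ) < s := zero_lt_one.trans hs
  lift s to ℝ≥0 using hs0.le
  have hs1 : 1 < s := by exact_mod_cast hs
  rw [div_lt_one (Real.log_pos hs)] at hlog
  refine ⟨s, hs1, ?_⟩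
  rw [← ENNReal.toReal_lt_toReal (ne_top_of_le_ne_top ENNReal.coe_ne_top
    (hB.dilationNorm_le hs1.le)) ENNReal.coe_ne_top]
  rcases ENNReal.toReal_nonneg.eq_or_lt with h0 | h0
  · rwa [← h0]
  · exact (Real.log_lt_log_iff h0 hs0).1 hlog

theorem exists_mul_le_of_upperBoydIndex_lt (hB : IsYoung B) (h : upperBoydIndex B < 1) :
    ∃ s a : ℝ≥0, 1 < a ∧ a < s ∧ ∀ t, s * B t ≤ B (a * t) := by
  obtain ⟨s, hs, hlt⟩ := hB.exists_dilationNorm_lt_of_upperBoydIndex_lt h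
  obtain ⟨a, ha, has⟩ := ENNReal.lt_iff_exists_nnreal_btwn.1 hlt
  have hs0 : 0 < s := zero_lt_one.trans hs
  have hgrowth : ∀ t, s * B t ≤ B (a * t) := by
    intro t
    rcases eq_zero_or_pos t with rfl | ht
    · simp [hB.map_zero]
    have hr : 0 < s * B t := mul_pos hs0 (hB.map_pos ht)
    have hratio := (hB.inverse_div_inverse_le_dilationNorm hs0 hr).trans ha.le
    rw [mul_div_cancel_left₀ _ hs0.ne', hB.inverse_map, ENNReal.coe_le_coe, div_le_iff₀ ht]
      at hratio
    exact (hB.map_inverse _).ge.trans (hB.strictMono.monotone hratio)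
  refine ⟨s, a, ?_, by exact_mod_cast has, hgrowth⟩
  rw [← hB.strictMono.lt_iff_lt]
  calc B 1 < s * B 1 := lt_mul_of_one_lt_left (hB.map_pos one_pos) hs
    _ ≤ B a := by simpa using hgrowth 1

end IsYoung

end BoydIndex

section MaximalBoyd

namespace IsYoung

variable {B : ℝ≥0 → ℝ≥0} {s a : ℝ≥0}

theorem extend_div_le_tsum (hB : IsYoung B) (ha : 1 < a) (y : ℝ≥0∞) :
    extend B (y / a) ≤
      ∑' i : ℤ, if ((a ^ i : ℝ≥0) : ℝ≥0∞) < y then (B (a ^ i) : ℝ≥0∞) else 0 := by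
  have ha0 : 0 < a := zero_lt_one.trans ha
  induction y with
  | top =>
    simp only [ENNReal.coe_lt_top, if_true]
    refine le_top.trans ?_
    rw [← ENNReal.tsum_const_eq_top_of_ne_zero (α := ℕ) (c := (B 1 : ℝ≥0∞))
      (by simpa using (hB.map_pos one_pos).ne')]
    refine le_trans (ENNReal.tsum_le_tsum fun i : ℕ => ?_) (ENNReal.tsum_comp_le_tsum_of_injective
      (Nat.cast_injective (R := ℤ)) fun i => (B (a ^ i) : ℝ≥0∞))
    exact_mod_cast hB.strictMono.monotone (one_le_zpow₀ ha.le (Int.natCast_nonneg i))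
  | coe y =>
    rcases eq_zero_or_pos y with rfl | hy
    · simp [hB.extend_zero]
    obtain ⟨i, hi, hi'⟩ := exists_mem_Ioc_zpow hy ha
    refine le_trans ?_ (ENNReal.le_tsum i)
    rw [if_pos (by exact_mod_cast hi), ← ENNReal.coe_div ha0.ne', extend_coe, ENNReal.coe_le_coe]
    refine hB.strictMono.monotone ((div_le_iff₀ ha0).2 ?_)
    rwa [← zpow_add_one₀ ha0.ne']

theorem mul_map_zpow_sub_div_le (hB : IsYoung B) (ha : 0 < a) (hs : 0 < s)
    (h : ∀ t, s * B t ≤ B (a * t)) {y : ℝ≥0} {I : ℤ} (hy : y ∈ Ioc (a ^ I) (a ^ (I + 1)))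
    (l : ℕ) :
    y * (B (a ^ (I - (l : ℤ))) / a ^ (I - (l : ℤ))) ≤ a * B y * (a / s) ^ l := by
  have hiter : ∀ l : ℕ, s ^ l * B (a ^ (I - (l : ℤ))) ≤ B (a ^ I) := by
    intro l
    induction l with
    | zero => simp
    | succ l ih =>
      calc s ^ (l + 1) * B (a ^ (I - ((l + 1 : ℕ) : ℤ)))
          = s ^ l * (s * B (a ^ (I - ((l + 1 : ℕ) : ℤ)))) := by rw [pow_succ, mul_assoc]
        _ ≤ s ^ l * B (a ^ (I - (l : ℤ))) := by
            gcongr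
            refine (h _).trans_eq ?_
            rw [← zpow_one_add₀ ha.ne']
            congr 2
            push_cast
            ring
        _ ≤ B (a ^ I) := ih
  have hdecay : B (a ^ (I - (l : ℤ))) ≤ B y / s ^ l := by
    rw [le_div_iff₀ (by positivity), mul_comm]
    exact (hiter l).trans (hB.strictMono.monotone hy.1.le)
  calc y * (B (a ^ (I - (l : ℤ))) / a ^ (I - (l : ℤ)))
      ≤ a ^ (I + 1) * ((B y / s ^ l) / a ^ (I - (l : ℤ))) := by
        gcongr
        exact hy.2
    _ = a * B y * (a / s) ^ l := by
        have haI : a ^ I ≠ 0 := zpow_ne_zero _ ha.ne'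
        rw [zpow_add_one₀ ha.ne', zpow_sub₀ ha.ne', zpow_natCast, div_pow]
        field_simp

theorem tsum_le_mul_extend (hB : IsYoung B) (ha : 1 < a) (has : a < s)
    (h : ∀ t, s * B t ≤ B (a * t)) (y : ℝ≥0∞) :
    ∑' i : ℤ, (if ((a ^ i : ℝ≥0) : ℝ≥0∞) < y then
      y * ((B (a ^ i) : ℝ≥0∞) / ((a ^ i : ℝ≥0) : ℝ≥0∞)) else 0) ≤
      ((a * (1 - a / s)⁻¹ : ℝ≥0) : ℝ≥0∞) * extend B y := by
  have ha0 : 0 < a := zero_lt_one.trans ha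
  have hs0 : 0 < s := ha0.trans has
  have hq : a / s < 1 := (div_lt_one hs0).2 has
  induction y with
  | top =>
    have hD : a * (1 - a / s)⁻¹ ≠ 0 := (mul_pos ha0 (inv_pos.2 (tsub_pos_of_lt hq))).ne'
    rw [extend_top, ENNReal.mul_top (by exact_mod_cast hD)]
    exact le_top
  | coe y =>
    rcases eq_zero_or_pos y with rfl | hy
    · simp
    obtain ⟨I, hI⟩ := exists_mem_Ioc_zpow hy ha
    have hinj : Function.Injective fun l : ℕ => I - (l : ℤ) := fun l l' hl => by simpa using hl
    rw [← hinj.tsum_eq]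
    · calc _ ≤ ∑' l : ℕ, ((a * B y * (a / s) ^ l : ℝ≥0) : ℝ≥0∞) := by
            refine ENNReal.tsum_le_tsum fun l => ?_
            split_ifs
            · rw [← ENNReal.coe_div (zpow_ne_zero _ ha0.ne'), ← ENNReal.coe_mul]
              exact_mod_cast hB.mul_map_zpow_sub_div_le ha0 hs0 h hI l
            · exact zero_le
        _ = ((a * (1 - a / s)⁻¹ : ℝ≥0) : ℝ≥0∞) * extend B y := by
            rw [← ENNReal.coe_tsum ((NNReal.summable_geometric hq).mul_left _),
              NNReal.tsum_mul_left, NNReal.tsum_geometric hq, extend_coe, ← ENNReal.coe_mul,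
              mul_right_comm]
    · intro i hi
      have hlt : a ^ i < y := by
        by_contra hcon
        exact hi (if_neg (by exact_mod_cast hcon))
      have hiI : i < I + 1 := (zpow_lt_zpow_iff_right₀ ha).1 (hlt.trans_le hI.2)
      exact ⟨(I - i).toNat, by simp only; omega⟩

theorem modular_maximal_div_le_tsum {X : Type*} [PseudoMetricSpace X] [MeasurableSpace X]
    [OpensMeasurableSpace X] {μ : Measure X} {f : X → ℝ≥0∞} (hB : IsYoung B) (ha : 1 < a) :
    modular B μ (fun x => maximal μ f x / ((2 * a : ℝ≥0) : ℝ≥0∞)) ≤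
      ∑' i : ℤ, B (a ^ i) * μ {x | 2 * ((a ^ i : ℝ≥0) : ℝ≥0∞) < maximal μ f x} := by
  have hmeas : ∀ i : ℤ, MeasurableSet {x | 2 * ((a ^ i : ℝ≥0) : ℝ≥0∞) < maximal μ f x} :=
    fun i => measurableSet_lt measurable_const (measurable_maximal μ f)
  have hdiv : ∀ x, maximal μ f x / ((2 * a : ℝ≥0) : ℝ≥0∞) = maximal μ f x / 2 / a := fun x => by
    rw [ENNReal.coe_mul, div_eq_mul_inv, ENNReal.mul_inv (.inl (by simp)) (.inl (by simp)),
      ← mul_assoc]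
    rfl
  calc modular B μ (fun x => maximal μ f x / ((2 * a : ℝ≥0) : ℝ≥0∞))
      ≤ ∫⁻ x, ∑' i : ℤ, {x | 2 * ((a ^ i : ℝ≥0) : ℝ≥0∞) < maximal μ f x}.indicator
          (fun _ => (B (a ^ i) : ℝ≥0∞)) x ∂μ := by
        refine lintegral_mono fun x => ?_
        simp only [hdiv, indicator_apply, mem_ofPred_eq]
        refine (hB.extend_div_le_tsum ha _).trans_eq (tsum_congr fun i => ?_)
        simp only [ENNReal.lt_div_iff_mul_lt (.inl two_ne_zero) (.inl ENNReal.ofNat_ne_top),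
          mul_comm]
    _ = ∑' i : ℤ, B (a ^ i) * μ {x | 2 * ((a ^ i : ℝ≥0) : ℝ≥0∞) < maximal μ f x} := by
        rw [lintegral_tsum fun i => (measurable_const.indicator (hmeas i)).aemeasurable]
        exact tsum_congr fun i => lintegral_indicator_const (hmeas i) _

variable {E : Type*} [NormedAddCommGroup E] [NormedSpace ℝ E] [FiniteDimensional ℝ E]
  [MeasurableSpace E] [BorelSpace E] [Nontrivial E] {μ : Measure E} [μ.IsAddHaarMeasure]
  {f : E → ℝ≥0∞}

theorem modular_maximal_div_le (hB : IsYoung B) (ha : 1 < a) (has : a < s)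
    (h : ∀ t, s * B t ≤ B (a * t)) (hf : AEMeasurable f μ) :
    modular B μ (fun x => maximal μ f x / ((2 * a : ℝ≥0) : ℝ≥0∞)) ≤
      ((5 ^ Module.finrank ℝ E * (a * (1 - a / s)⁻¹) : ℝ≥0) : ℝ≥0∞) * modular B μ f := by
  have hpos : ∀ i : ℤ, ((a ^ i : ℝ≥0) : ℝ≥0∞) ≠ 0 := fun i => by
    simpa using (zpow_pos (zero_lt_one.trans ha) i).ne'
  have hnull : ∀ i : ℤ, NullMeasurableSet {x | ((a ^ i : ℝ≥0) : ℝ≥0∞) < f x} μ := fun i =>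
    nullMeasurableSet_lt aemeasurable_const hf
  have hlevel : ∀ i : ℤ, B (a ^ i) * μ {x | 2 * ((a ^ i : ℝ≥0) : ℝ≥0∞) < maximal μ f x} ≤
      5 ^ Module.finrank ℝ E * ∫⁻ x, {x | ((a ^ i : ℝ≥0) : ℝ≥0∞) < f x}.indicator
        (fun x => f x * ((B (a ^ i) : ℝ≥0∞) / ((a ^ i : ℝ≥0) : ℝ≥0∞))) x ∂μ := fun i => by
    rw [lintegral_indicator₀ (hnull i), lintegral_mul_const' _ _
      (ENNReal.div_ne_top ENNReal.coe_ne_top (hpos i))]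
    calc _ ≤ (B (a ^ i) : ℝ≥0∞) * (5 ^ Module.finrank ℝ E *
            ((∫⁻ x in {x | ((a ^ i : ℝ≥0) : ℝ≥0∞) < f x}, f x ∂μ) / ((a ^ i : ℝ≥0) : ℝ≥0∞))) := by
          gcongr
          exact measure_two_mul_lt_maximal_le hf (hpos i) ENNReal.coe_ne_top
      _ = _ := by simp only [div_eq_mul_inv]; ring
  calc modular B μ (fun x => maximal μ f x / ((2 * a : ℝ≥0) : ℝ≥0∞))
      ≤ ∑' i : ℤ, 5 ^ Module.finrank ℝ E * ∫⁻ x, {x | ((a ^ i : ℝ≥0) : ℝ≥0∞) < f x}.indicator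
          (fun x => f x * ((B (a ^ i) : ℝ≥0∞) / ((a ^ i : ℝ≥0) : ℝ≥0∞))) x ∂μ :=
        (hB.modular_maximal_div_le_tsum ha).trans (ENNReal.tsum_le_tsum hlevel)
    _ = 5 ^ Module.finrank ℝ E * ∫⁻ x, ∑' i : ℤ, {x | ((a ^ i : ℝ≥0) : ℝ≥0∞) < f x}.indicator
          (fun x => f x * ((B (a ^ i) : ℝ≥0∞) / ((a ^ i : ℝ≥0) : ℝ≥0∞))) x ∂μ := by
        rw [ENNReal.tsum_mul_left, lintegral_tsum fun i => (hf.mul_const _).indicator₀ (hnull i)]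
    _ ≤ 5 ^ Module.finrank ℝ E *
          ∫⁻ x, ((a * (1 - a / s)⁻¹ : ℝ≥0) : ℝ≥0∞) * extend B (f x) ∂μ := by
        gcongr with x
        simpa only [indicator_apply, mem_ofPred_eq] using hB.tsum_le_mul_extend ha has h (f x)
    _ = _ := by
        rw [lintegral_const_mul' _ _ ENNReal.coe_ne_top, ENNReal.coe_mul (5 ^ _), mul_assoc]
        simp [modular]

theorem exists_luxemburg_maximal_le_of_upperBoydIndex_lt (hB : IsYoung B)
    (h : upperBoydIndex B < 1) (μ : Measure E) [μ.IsAddHaarMeasure] :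
    ∃ K : ℝ≥0, ∀ f : E → ℝ≥0∞, AEMeasurable f μ →
      luxemburg B μ (maximal μ f) ≤ K * luxemburg B μ f := by
  obtain ⟨s, a, ha, has, hgrowth⟩ := hB.exists_mul_le_of_upperBoydIndex_lt h
  have ha0 : 0 < a := zero_lt_one.trans ha
  have hq : a / s < 1 := (div_lt_one (ha0.trans has)).2 has
  have hD : 1 ≤ 5 ^ Module.finrank ℝ E * (a * (1 - a / s)⁻¹) :=
    one_le_mul (one_le_pow₀ (by norm_num))
      (one_le_mul ha.le ((one_le_inv₀ (tsub_pos_of_lt hq)).2 tsub_le_self))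
  refine ⟨_, fun f hf => hB.luxemburg_le_mul_luxemburg hD (p := 2 * a) (by positivity)
    fun l hl hmod => ?_⟩
  have hl0 : (l : ℝ≥0∞) ≠ 0 := by simpa using hl.ne'
  have hscale : (fun x => maximal μ f x / ((2 * a * l : ℝ≥0) : ℝ≥0∞)) =
      fun x => maximal μ (fun y => (l : ℝ≥0∞)⁻¹ * f y) x / ((2 * a : ℝ≥0) : ℝ≥0∞) := by
    ext x
    rw [maximal_const_mul (ENNReal.inv_ne_top.2 hl0), ENNReal.coe_mul (2 * a), div_eq_mul_inv,
      ENNReal.mul_inv (.inr ENNReal.coe_ne_top) (.inr hl0), div_eq_mul_inv]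
    ring
  simp only [ENNReal.div_eq_inv_mul] at hmod
  rw [hscale]
  exact (hB.modular_maximal_div_le ha has hgrowth (hf.const_mul _)).trans
    (mul_le_of_le_one_right' hmod)

end IsYoung

end MaximalBoyd

/-! ### Pointwise gradient bounds -/

section IteratedFDeriv

variable {E F : Type*} [NormedAddCommGroup E] [NormedSpace ℝ E] [NormedAddCommGroup F]
  [NormedSpace ℝ F] {f : E → F}

theorem contDiff_iteratedFDeriv_apply (hf : ContDiff ℝ ∞ f) (m : ℕ) (w : Fin m → E) :
    ContDiff ℝ ∞ fun x => iteratedFDeriv ℝ m f x w :=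
  (ContinuousMultilinearMap.apply ℝ (fun _ : Fin m => E) F w).contDiff.comp
    (hf.iteratedFDeriv_right (by exact_mod_cast le_top))

theorem contDiff_fderiv_apply_const (hf : ContDiff ℝ ∞ f) (v : E) :
    ContDiff ℝ ∞ fun x => fderiv ℝ f x v :=
  (hf.fderiv_right (by simp)).clm_apply contDiff_const

theorem fderiv_iteratedFDeriv_apply (hf : ContDiff ℝ ∞ f) {m : ℕ} (w : Fin (m + 1) → E) (x : E) :
    fderiv ℝ (fun y => iteratedFDeriv ℝ m f y (Fin.tail w)) x (w 0) =
      iteratedFDeriv ℝ (m + 1) f x w := by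
  have hd : Differentiable ℝ (iteratedFDeriv ℝ m f) :=
    hf.differentiable_iteratedFDeriv (by exact_mod_cast ENat.natCast_lt_top m)
  rw [iteratedFDeriv_succ_apply_left]
  exact DFunLike.congr_fun ((ContinuousMultilinearMap.apply ℝ (fun _ : Fin m => E) F
    (Fin.tail w)).hasFDerivAt.comp x (hd x).hasFDerivAt).fderiv (w 0)

theorem fderiv_fderiv_apply_comm (hf : ContDiff ℝ ∞ f) (v w x : E) :
    fderiv ℝ (fun y => fderiv ℝ f y v) x w = fderiv ℝ (fun y => fderiv ℝ f y w) x v := by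
  have hd : DifferentiableAt ℝ (fderiv ℝ f) x :=
    (hf.fderiv_right (m := ∞) (by simp)).differentiable (by simp) x
  have hsymm : IsSymmSndFDerivAt ℝ f x := hf.contDiffAt.isSymmSndFDerivAt (by
    rw [minSmoothness_of_isRCLikeNormedField]
    exact WithTop.coe_le_coe.2 (le_top (a := (2 : ℕ∞))))
  rw [fderiv_clm_apply hd (differentiableAt_const v),
    fderiv_clm_apply hd (differentiableAt_const w)]
  simpa using hsymm w v

theorem iteratedFDeriv_fderiv_apply_comm (hf : ContDiff ℝ ∞ f) {m : ℕ} (w : Fin m → E) (v x : E) :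
    iteratedFDeriv ℝ m (fun y => fderiv ℝ f y v) x w =
      fderiv ℝ (fun y => iteratedFDeriv ℝ m f y w) x v := by
  induction m generalizing x with
  | zero => simp
  | succ m ih =>
    rw [← fderiv_iteratedFDeriv_apply (contDiff_fderiv_apply_const hf v)]
    simp only [ih, ← fderiv_iteratedFDeriv_apply hf]
    exact fderiv_fderiv_apply_comm (contDiff_iteratedFDeriv_apply hf m _) _ _ _

theorem iteratedFDeriv_fderiv_apply (hf : ContDiff ℝ ∞ f) {m : ℕ} (w : Fin (m + 1) → E) (x : E) :
    iteratedFDeriv ℝ m (fun y => fderiv ℝ f y (w 0)) x (Fin.tail w) =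
      iteratedFDeriv ℝ (m + 1) f x w := by
  rw [iteratedFDeriv_fderiv_apply_comm hf, fderiv_iteratedFDeriv_apply hf]

theorem iteratedFDeriv_comp_add_smul (hf : ContDiff ℝ ∞ f) (m : ℕ) (x : E) (a : ℝ) (y : E) :
    iteratedFDeriv ℝ m (fun y => f (x + a • y)) y = a ^ m • iteratedFDeriv ℝ m f (x + a • y) := by
  have hfx : ContDiff ℝ m fun y => f (x + y) :=
    (hf.of_le (by exact_mod_cast le_top)).comp (contDiff_const.add contDiff_id)
  rw [iteratedFDeriv_comp_const_smul a hfx]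
  simp only [iteratedFDeriv_comp_add_left]

theorem hasDerivAt_iteratedFDeriv_comp_add_smul (hf : ContDiff ℝ ∞ f) (m : ℕ) (x y : E) (s : ℝ) :
    HasDerivAt (fun s : ℝ => iteratedFDeriv ℝ m f (x + s • y) fun _ => y)
      (iteratedFDeriv ℝ (m + 1) f (x + s • y) fun _ => y) s := by
  have hline : HasDerivAt (fun s : ℝ => x + s • y) y s := by
    simpa using ((hasDerivAt_id s).smul_const y).const_add x
  rw [← fderiv_iteratedFDeriv_apply hf]
  exact ((contDiff_iteratedFDeriv_apply hf m _).differentiable (by simp) _).hasFDerivAt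
    |>.comp_hasDerivAt s hline

theorem norm_iteratedFDeriv_iteratedFDeriv_apply_le (hf : ContDiff ℝ ∞ f) {j : ℕ} (m : ℕ)
    {w : Fin j → E} (hw : ∀ i, ‖w i‖ ≤ 1) (x : E) :
    ‖iteratedFDeriv ℝ m (fun z => iteratedFDeriv ℝ j f z w) x‖ ≤
      ‖iteratedFDeriv ℝ (j + m) f x‖ := by
  induction j generalizing f with
  | zero =>
    rw [zero_add]
    simp
  | succ j ih =>
    simp only [← iteratedFDeriv_fderiv_apply hf]
    calc _ ≤ ‖iteratedFDeriv ℝ (j + m) (fun y => fderiv ℝ f y (w 0)) x‖ :=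
          ih (contDiff_fderiv_apply_const hf (w 0)) fun i => hw i.succ
      _ ≤ ‖w 0‖ * ‖iteratedFDeriv ℝ (j + m) (fderiv ℝ f) x‖ :=
          norm_iteratedFDeriv_clm_apply_const (hf.fderiv_right (m := ∞) (by simp)).contDiffAt
            (by exact_mod_cast le_top)
      _ ≤ ‖iteratedFDeriv ℝ (j + 1 + m) f x‖ := by
          rw [norm_iteratedFDeriv_fderiv, Nat.succ_add_eq_add_succ]
          exact mul_le_of_le_one_left (norm_nonneg _) (hw 0)

variable [FiniteDimensional ℝ E] [MeasurableSpace E] [BorelSpace E] {μ : Measure E}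

theorem integral_iteratedFDeriv_mul [μ.IsAddHaarMeasure] {V φ : E → ℝ} (hV : ContDiff ℝ ∞ V)
    (hφ : ContDiff ℝ ∞ φ) (hc : HasCompactSupport φ) (m : ℕ) (w : Fin m → E) :
    ∫ y, V y * iteratedFDeriv ℝ m φ y w ∂μ = (-1) ^ m * ∫ y, iteratedFDeriv ℝ m V y w * φ y ∂μ := by
  induction m generalizing φ with
  | zero => simp
  | succ m ih =>
    have hφ' := contDiff_fderiv_apply_const hφ (w 0)
    have hc' : HasCompactSupport fun y => fderiv ℝ φ y (w 0) := hc.fderiv_apply ℝ (w 0)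
    have hD := contDiff_iteratedFDeriv_apply hV m (Fin.tail w)
    have hD' := contDiff_fderiv_apply_const hD (w 0)
    have hparts := integral_mul_fderiv_eq_neg_fderiv_mul_of_integrable (μ := μ) (v := w 0)
      ((hD'.continuous.mul hφ.continuous).integrable_of_hasCompactSupport hc.mul_left)
      ((hD.continuous.mul hφ'.continuous).integrable_of_hasCompactSupport hc'.mul_left)
      ((hD.continuous.mul hφ.continuous).integrable_of_hasCompactSupport hc.mul_left)
      (fun y _ => hD.differentiable (by simp) y) (fun y _ => hφ.differentiable (by simp) y)
    simp only [← iteratedFDeriv_fderiv_apply hφ, ← fderiv_iteratedFDeriv_apply hV]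
    rw [ih hφ' hc', hparts, pow_succ, mul_neg_one, neg_mul, mul_neg]

theorem iteratedFDeriv_convolution [μ.IsAddHaarMeasure] {u φ : E → ℝ} (hu : LocallyIntegrable u μ)
    (hφ : ContDiff ℝ ∞ φ) (hc : HasCompactSupport φ) (m : ℕ) (w : Fin m → E) (x : E) :
    iteratedFDeriv ℝ m (convolution u φ (ContinuousLinearMap.lsmul ℝ ℝ) μ) x w =
      convolution u (fun z => iteratedFDeriv ℝ m φ z w) (ContinuousLinearMap.lsmul ℝ ℝ) μ x := by
  induction m generalizing φ with
  | zero => simp [convolution]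
  | succ m ih =>
    have hfderiv : (fun y => fderiv ℝ (convolution u φ (ContinuousLinearMap.lsmul ℝ ℝ) μ) y (w 0)) =
        convolution u (fun y => fderiv ℝ φ y (w 0)) (ContinuousLinearMap.lsmul ℝ ℝ) μ := by
      ext y
      rw [(hc.hasFDerivAt_convolution_right _ hu (hφ.of_le (by simp)) y).fderiv,
        convolution_precompR_apply _ hu (hc.fderiv ℝ) (hφ.continuous_fderiv (by simp))]
    rw [← iteratedFDeriv_fderiv_apply (hc.contDiff_convolution_right _ hu hφ), hfderiv,
      ih (contDiff_fderiv_apply_const hφ (w 0)) (hc.fderiv_apply ℝ (w 0))]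
    simp only [iteratedFDeriv_fderiv_apply hφ]

end IteratedFDeriv

theorem hasDerivAt_integral_mul_of_continuous {X : Type*} [TopologicalSpace X]
    [MeasurableSpace X] [OpensMeasurableSpace X] [SecondCountableTopology X] {μ : Measure X}
    [IsFiniteMeasureOnCompacts μ] {G G' : ℝ → X → ℝ}
    {φ : X → ℝ} (hG : Continuous (Function.uncurry G)) (hG' : Continuous (Function.uncurry G'))
    (hd : ∀ r y, HasDerivAt (fun r => G r y) (G' r y) r) (hφ : Continuous φ)
    (hc : HasCompactSupport φ) (r : ℝ) :
    HasDerivAt (fun r => ∫ y, G r y * φ y ∂μ) (∫ y, G' r y * φ y ∂μ) r := by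
  have hK : IsCompact (closedBall r 1 ×ˢ tsupport φ) := (isCompact_closedBall r 1).prod hc
  obtain ⟨c, hbound⟩ := hK.exists_bound_of_continuousOn hG'.continuousOn
  have hGr : ∀ r, Continuous (G r) := fun r => hG.comp (by fun_prop : Continuous fun y => (r, y))
  have hG'r : ∀ r, Continuous (G' r) := fun r => hG'.comp (by fun_prop : Continuous fun y => (r, y))
  refine (hasDerivAt_integral_of_dominated_loc_of_deriv_le (F := fun r y => G r y * φ y)
    (F' := fun r y => G' r y * φ y) (bound := fun y => c * ‖φ y‖) (s := closedBall r 1)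
    (closedBall_mem_nhds r one_pos)
    (Eventually.of_forall fun r => ((hGr r).mul hφ).aestronglyMeasurable)
    (((hGr r).mul hφ).integrable_of_hasCompactSupport hc.mul_left)
    ((hG'r r).mul hφ).aestronglyMeasurable
    (Eventually.of_forall fun y q hq => ?_)
    ((hφ.norm.integrable_of_hasCompactSupport hc.norm).const_mul c)
    (Eventually.of_forall fun y q _ => (hd q y).mul_const (φ y))).2
  rw [norm_mul]
  by_cases hy : y ∈ tsupport φ
  · gcongr
    exact hbound (q, y) ⟨hq, hy⟩
  · simp [image_eq_zero_of_notMem_tsupport hy]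

section FiniteDifference

variable {G : Type*} [NormedAddCommGroup G] [NormedSpace ℝ G]

theorem enorm_sub_le_of_enorm_hasDerivAt_le {f f' : ℝ → G} {s : ℝ} {h : ℝ≥0} {N : ℝ≥0∞}
    (hf : ∀ r, s ≤ r → HasDerivAt f (f' r) r) (hN : ∀ r, s ≤ r → ‖f' r‖ₑ ≤ N) :
    ‖f (s + h) - f s‖ₑ ≤ h * N := by
  rcases eq_zero_or_pos h with rfl | hh
  · simp
  induction N with
  | top => simp [ENNReal.mul_top, hh.ne']
  | coe N =>
    have hmean := (convex_Ici s).norm_image_sub_le_of_norm_hasDerivWithin_le (C := N) (y := s + h)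
      (fun r hr => (hf r hr).hasDerivWithinAt) (fun r hr => by exact_mod_cast hN r hr)
      self_mem_Ici (mem_Ici.2 (le_add_of_nonneg_right h.2))
    rw [add_sub_cancel_left, NNReal.norm_eq, mul_comm] at hmean
    exact_mod_cast hmean

/- Induction on `m`, replacing `F` by its difference with step `h`; the summand `P` on the left
absorbs the value `F 0 h` in each step. -/
theorem add_enorm_apply_zero_le_of_hasDerivAt (m : ℕ) {F : ℕ → ℝ → G} {h : ℝ≥0} {P N : ℝ≥0∞}
    (hF : ∀ i s, HasDerivAt (F i) (F (i + 1) s) s) (hN : ∀ s, 0 ≤ s → ‖F m s‖ₑ ≤ N)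
    (hP : ∀ s, (h : ℝ) ≤ s → ‖F 0 s‖ₑ ≤ P) : P + ‖F 0 0‖ₑ ≤ 2 ^ m * P + h ^ m * N := by
  induction m generalizing F P N with
  | zero => simpa using add_le_add_right (hN 0 le_rfl) P
  | succ m ih =>
    have hdiff := ih (F := fun i s => F i (s + h) - F i s) (P := 2 * P) (N := h * N)
      (fun i s => ((hF i (s + h)).comp_add_const s h).sub (hF i s))
      (fun s hs => enorm_sub_le_of_enorm_hasDerivAt_le (fun r _ => hF m r)
        fun r hr => hN r (hs.trans hr))
      (fun s hs => by
        rw [two_mul]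
        exact (enorm_sub_le).trans (add_le_add (hP _ (by linarith [h.2])) (hP s hs)))
    calc P + ‖F 0 0‖ₑ ≤ P + (P + ‖F 0 (0 + h) - F 0 0‖ₑ) := by
          gcongr
          calc ‖F 0 0‖ₑ = ‖F 0 (0 + h) - (F 0 (0 + h) - F 0 0)‖ₑ := by rw [sub_sub_cancel]
            _ ≤ P + ‖F 0 (0 + h) - F 0 0‖ₑ :=
              enorm_sub_le.trans (by gcongr; exact hP _ (by simp))
      _ ≤ 2 ^ m * (2 * P) + h ^ m * (h * N) := by rwa [← add_assoc, ← two_mul]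
      _ = 2 ^ (m + 1) * P + h ^ (m + 1) * N := by ring

end FiniteDifference

section SmoothPointwise

theorem enorm_integral_mul_le {X : Type*} [MeasurableSpace X] {μ : Measure X} {S : Set X}
    (hS : MeasurableSet S) {f ψ : X → ℝ} {c : ℝ≥0} (hψ : ∀ y, ‖ψ y‖ₑ ≤ c)
    (hsupp : ∀ y, y ∉ S → ψ y = 0) :
    ‖∫ y, f y * ψ y ∂μ‖ₑ ≤ c * ∫⁻ y in S, ‖f y‖ₑ ∂μ := by
  rw [← lintegral_const_mul' _ _ ENNReal.coe_ne_top, ← lintegral_indicator hS]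
  refine (enorm_integral_le_lintegral_enorm _).trans (lintegral_mono fun y => ?_)
  by_cases hy : y ∈ S
  · rw [indicator_of_mem hy, enorm_mul, mul_comm]
    gcongr
    exact hψ y
  · simp [hsupp y hy]

theorem exists_enorm_le_of_hasCompactSupport {X G : Type*} [TopologicalSpace X]
    [NormedAddCommGroup G] {g : X → G} (hg : Continuous g) (hc : HasCompactSupport g) :
    ∃ c : ℝ≥0, ∀ y, ‖g y‖ₑ ≤ c := by
  obtain ⟨c, hcg⟩ := hc.exists_bound_of_continuous hg
  exact ⟨c.toNNReal, fun y => by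
    rw [← ofReal_norm]
    exact ENNReal.ofReal_le_ofReal (hcg y)⟩

variable {E : Type*} [NormedAddCommGroup E] [NormedSpace ℝ E] [MeasurableSpace E] [BorelSpace E]
  {μ : Measure E} {U φ : E → ℝ} {c : ℝ≥0}

theorem enorm_integral_iteratedFDeriv_iteratedFDeriv_mul_le (hU : ContDiff ℝ ∞ U)
    (hc : ∀ y, ‖φ y‖ₑ ≤ c) (hsupp : tsupport φ ⊆ ball 0 1) {j : ℕ} (m : ℕ) {w : Fin j → E}
    (hw : ∀ i, ‖w i‖ ≤ 1) (x : E) (s : ℝ) :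
    ‖∫ y, iteratedFDeriv ℝ m (fun z => iteratedFDeriv ℝ j U z w) (x + s • y) (fun _ => y) * φ y ∂μ‖ₑ
      ≤ c * ∫⁻ y in ball 0 1, ‖iteratedFDeriv ℝ (j + m) U (x + s • y)‖ₑ ∂μ := by
  refine (enorm_integral_mul_le measurableSet_ball hc fun y hy =>
    image_eq_zero_of_notMem_tsupport fun hy' => hy (hsupp hy')).trans ?_
  gcongr c * ?_
  refine setLIntegral_mono' measurableSet_ball fun y hy => enorm_le_iff_norm_le.2 ?_
  exact (ContinuousMultilinearMap.unit_le_opNorm _ ((pi_norm_le_iff_of_nonneg zero_le_one).2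
    fun _ => (mem_ball_zero_iff.1 hy).le)).trans
      (norm_iteratedFDeriv_iteratedFDeriv_apply_le hU m hw _)

variable [FiniteDimensional ℝ E]

theorem exists_contDiff_tsupport_subset_integral_eq_one (μ : Measure E) [μ.IsAddHaarMeasure] :
    ∃ φ : E → ℝ, ContDiff ℝ ∞ φ ∧ HasCompactSupport φ ∧ tsupport φ ⊆ ball 0 1 ∧
      ∫ y, φ y ∂μ = 1 := by
  let b : ContDiffBump (0 : E) := ⟨1 / 4, 1 / 2, by norm_num, by norm_num⟩
  refine ⟨b.normed μ, b.contDiff_normed, b.hasCompactSupport_normed, ?_, b.integral_normed⟩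
  rw [b.tsupport_normed_eq]
  exact closedBall_subset_ball (by norm_num [b])

theorem enorm_pow_mul_enorm_integral_iteratedFDeriv_mul_le [μ.IsAddHaarMeasure]
    (hU : ContDiff ℝ ∞ U) (hφ : ContDiff ℝ ∞ φ) (hφc : HasCompactSupport φ)
    (hsupp : tsupport φ ⊆ ball 0 1) {j : ℕ} (hc : ∀ y, ‖iteratedFDeriv ℝ j φ y‖ₑ ≤ c)
    {w : Fin j → E} (hw : ∀ i, ‖w i‖ ≤ 1) (x : E) (s : ℝ) :
    ‖s‖ₑ ^ j * ‖∫ y, iteratedFDeriv ℝ j U (x + s • y) w * φ y ∂μ‖ₑ ≤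
      c * ∫⁻ y in ball 0 1, ‖U (x + s • y)‖ₑ ∂μ := by
  have hparts := integral_iteratedFDeriv_mul (μ := μ)
    (hU.comp (by fun_prop : ContDiff ℝ ∞ fun y => x + s • y)) hφ hφc j w
  simp only [Function.comp_def, iteratedFDeriv_comp_add_smul hU, smul_apply,
    smul_eq_mul, mul_assoc, integral_const_mul] at hparts
  calc _ = ‖∫ y, U (x + s • y) * iteratedFDeriv ℝ j φ y w ∂μ‖ₑ := by
        rw [hparts]
        simp [enorm_mul, enorm_pow]
    _ ≤ _ := enorm_integral_mul_le measurableSet_ball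
        (fun y => (enorm_le_iff_norm_le.2 (ContinuousMultilinearMap.unit_le_opNorm _
          ((pi_norm_le_iff_of_nonneg zero_le_one).2 hw))).trans (hc y))
        fun y hy => by
          rw [image_eq_zero_of_notMem_tsupport (f := iteratedFDeriv ℝ j φ) fun hy' =>
            hy (hsupp (tsupport_iteratedFDeriv_subset j hy'))]
          rfl

theorem hasDerivAt_integral_iteratedFDeriv_add_smul_mul [IsFiniteMeasureOnCompacts μ] {V : E → ℝ}
    (hV : ContDiff ℝ ∞ V) (hφ : Continuous φ) (hφc : HasCompactSupport φ) (x : E) (i : ℕ) (s : ℝ) :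
    HasDerivAt (fun s : ℝ => ∫ y, iteratedFDeriv ℝ i V (x + s • y) (fun _ => y) * φ y ∂μ)
      (∫ y, iteratedFDeriv ℝ (i + 1) V (x + s • y) (fun _ => y) * φ y ∂μ) s := by
  have hcont (i : ℕ) : Continuous (Function.uncurry fun (s : ℝ) (y : E) =>
      iteratedFDeriv ℝ i V (x + s • y) fun _ => y) :=
    ((hV.continuous_iteratedFDeriv (m := i) (by exact_mod_cast le_top)).comp
      (by fun_prop : Continuous fun p : ℝ × E => x + p.1 • p.2)).eval (by fun_prop)
  exact hasDerivAt_integral_mul_of_continuous (hcont i) (hcont (i + 1))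
    (fun s y => hasDerivAt_iteratedFDeriv_comp_add_smul hV i x y s) hφ hφc s

/- The means `∫ D^j U(x + s y) w φ(y) dy` join the derivative at `x` (for `s = 0`) to quantities
which, for `s ≥ h`, are bounded by means of `U` after `j` integrations by parts; their `m`-th
derivative in `s` is a mean of the derivatives of order `j + m`. -/
theorem exists_enorm_iteratedFDeriv_apply_le (μ : Measure E) [μ.IsAddHaarMeasure] (j m : ℕ) :
    ∃ c : ℝ≥0, ∀ (U : E → ℝ) (x : E) (P N : ℝ≥0∞), ContDiff ℝ ∞ U →
      (∀ r : ℝ, 0 < r → ∫⁻ y in ball 0 1, ‖U (x + r • y)‖ₑ ∂μ ≤ P) →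
      (∀ r : ℝ, 0 ≤ r →
        ∫⁻ y in ball 0 1, ‖iteratedFDeriv ℝ (j + m) U (x + r • y)‖ₑ ∂μ ≤ N) →
      ∀ w : Fin j → E, (∀ i, ‖w i‖ ≤ 1) → ∀ h : ℝ≥0, 0 < h →
        ‖iteratedFDeriv ℝ j U x w‖ₑ ≤ c * (P / h ^ j + h ^ m * N) := by
  obtain ⟨φ, hφ, hφc, hsupp, hint⟩ := exists_contDiff_tsupport_subset_integral_eq_one μ
  obtain ⟨c₁, hc₁⟩ := exists_enorm_le_of_hasCompactSupport hφ.continuous hφc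
  obtain ⟨c₂, hc₂⟩ := exists_enorm_le_of_hasCompactSupport
    (hφ.continuous_iteratedFDeriv (m := j) (by exact_mod_cast le_top)) (hφc.iteratedFDeriv j)
  refine ⟨2 ^ m * c₂ + c₁, fun U x P N hU hP hN w hw h hh => ?_⟩
  let F (i : ℕ) (s : ℝ) : ℝ := ∫ y, iteratedFDeriv ℝ i (fun z => iteratedFDeriv ℝ j U z w)
    (x + s • y) (fun _ => y) * φ y ∂μ
  have hF0 : F 0 0 = iteratedFDeriv ℝ j U x w := by
    simp [F, integral_const_mul, hint]
  have hFP (s : ℝ) (hs : (h : ℝ) ≤ s) : ‖F 0 s‖ₑ ≤ c₂ * (P / h ^ j) := by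
    have hs0 : 0 < s := lt_of_lt_of_le hh hs
    have hhs : (h : ℝ≥0∞) ≤ ‖s‖ₑ := by
      rw [Real.enorm_of_nonneg hs0.le, ← ENNReal.ofReal_coe_nnreal]
      exact ENNReal.ofReal_le_ofReal hs
    rw [← mul_div_assoc, ENNReal.le_div_iff_mul_le (by simp [hh.ne']) (by simp), mul_comm]
    calc (h : ℝ≥0∞) ^ j * ‖F 0 s‖ₑ ≤ ‖s‖ₑ ^ j * ‖F 0 s‖ₑ := by gcongr
      _ ≤ c₂ * ∫⁻ y in ball 0 1, ‖U (x + s • y)‖ₑ ∂μ :=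
          enorm_pow_mul_enorm_integral_iteratedFDeriv_mul_le hU hφ hφc hsupp hc₂ hw x s
      _ ≤ c₂ * P := by
          gcongr
          exact hP s hs0
  have hFN (s : ℝ) (hs : 0 ≤ s) : ‖F m s‖ₑ ≤ c₁ * N :=
    (enorm_integral_iteratedFDeriv_iteratedFDeriv_mul_le hU hc₁ hsupp m hw x s).trans (by
      gcongr
      exact hN s hs)
  calc ‖iteratedFDeriv ℝ j U x w‖ₑ ≤ c₂ * (P / h ^ j) + ‖F 0 0‖ₑ := by
        rw [hF0]
        exact le_add_self
    _ ≤ 2 ^ m * (c₂ * (P / h ^ j)) + h ^ m * (c₁ * N) :=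
        add_enorm_apply_zero_le_of_hasDerivAt m (hasDerivAt_integral_iteratedFDeriv_add_smul_mul
          (contDiff_iteratedFDeriv_apply hU j w) hφ.continuous hφc x) hFN hFP
    _ = (2 ^ m * c₂) * (P / h ^ j) + c₁ * (h ^ m * N) := by ring
    _ ≤ ((2 ^ m * c₂ + c₁ : ℝ≥0) : ℝ≥0∞) * (P / h ^ j + h ^ m * N) := by
        push_cast
        rw [mul_add]
        gcongr
        · exact le_self_add
        · exact le_add_self

end SmoothPointwise

section Mollification

theorem setLIntegral_ball_comp_sub {E : Type*} [NormedAddCommGroup E] [MeasurableSpace E]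
    [BorelSpace E] (μ : Measure E) [μ.IsAddRightInvariant] (f : E → ℝ≥0∞) (x w : E) (r : ℝ) :
    ∫⁻ z in ball x r, f (z - w) ∂μ = ∫⁻ z in ball (x - w) r, f z ∂μ := by
  have hball : (· - w) ⁻¹' ball (x - w) r = ball x r := by
    ext z
    simp
  rw [← hball]
  exact (measurePreserving_sub_right μ w).setLIntegral_comp_preimage_emb
    (Homeomorph.subRight w).measurableEmbedding f _

variable {E : Type*} [NormedAddCommGroup E] [NormedSpace ℝ E] [FiniteDimensional ℝ E]
  [MeasurableSpace E] [BorelSpace E]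

/-- The mollification `g ∗ φ` of `g`, where `φ` is the bump function `b` normalised to have
integral `1` with respect to `μ`. -/
def mollify (b : ContDiffBump (0 : E)) (μ : Measure E) (g : E → ℝ) : E → ℝ :=
  convolution g (b.normed μ) (ContinuousLinearMap.lsmul ℝ ℝ) μ

variable {μ : Measure E} [μ.IsAddHaarMeasure]

theorem setLIntegral_ball_comp_add_smul (f : E → ℝ≥0∞) (x : E) {r : ℝ} (hr : 0 < r) :
    ENNReal.ofReal r ^ Module.finrank ℝ E * ∫⁻ y in ball 0 1, f (x + r • y) ∂μ =
      ∫⁻ z in ball x r, f z ∂μ := by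
  have hemb : MeasurableEmbedding fun y : E => x + r • y :=
    ((Homeomorph.smulOfNeZero r hr.ne').trans (Homeomorph.addLeft x)).measurableEmbedding
  have hmap : Measure.map (fun y => x + r • y) μ =
      ENNReal.ofReal (r ^ Module.finrank ℝ E)⁻¹ • μ := by
    rw [← Function.comp_def (x + ·) (r • ·), ← Measure.map_map (measurable_const_add x)
      (measurable_const_smul r), Measure.map_addHaar_smul μ hr.ne', Measure.map_smul,
      map_add_left_eq_self, abs_of_pos (by positivity)]
  have hball : (fun y => x + r • y) ⁻¹' ball x r = ball 0 1 := by
    ext y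
    rw [mem_preimage, mem_ball_iff_norm, add_sub_cancel_left, norm_smul, Real.norm_of_nonneg hr.le,
      mem_ball_zero_iff, mul_lt_iff_lt_one_right hr]
  rw [← hball, ← hemb.lintegral_map f, ← hemb.restrict_map, hmap, Measure.restrict_smul,
    lintegral_smul_measure, smul_eq_mul, ← mul_assoc, ← ENNReal.ofReal_pow hr.le,
    ← ENNReal.ofReal_mul (by positivity), mul_inv_cancel₀ (by positivity), ENNReal.ofReal_one,
    one_mul]

variable (b : ContDiffBump (0 : E)) {g : E → ℝ} {r : ℝ}

theorem enorm_mollify_le_lintegral (z : E) :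
    ‖mollify b μ g z‖ₑ ≤ ∫⁻ w, ‖b.normed μ w‖ₑ * ‖g (z - w)‖ₑ ∂μ := by
  refine (enorm_integral_le_lintegral_enorm _).trans_eq ?_
  rw [← lintegral_sub_left_eq_self _ z]
  refine lintegral_congr fun w => ?_
  rw [ContinuousLinearMap.lsmul_apply, smul_eq_mul, sub_sub_cancel, enorm_mul, mul_comm]

theorem lintegral_enorm_normed : ∫⁻ w, ‖b.normed μ w‖ₑ ∂μ = 1 := by
  rw [← ofReal_integral_norm_eq_lintegral_enorm b.integrable_normed]
  simp only [Real.norm_of_nonneg (b.nonneg_normed _), b.integral_normed, ENNReal.ofReal_one]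

theorem enorm_normed_le (hb : b.rOut ≤ 2 * b.rIn) (w z : E) :
    ‖b.normed μ w‖ₑ ≤ 2 ^ Module.finrank ℝ E / μ (ball z b.rOut) := by
  have hpos : 0 < μ.real (closedBall (0 : E) b.rOut) :=
    ENNReal.toReal_pos (measure_closedBall_pos μ _ b.rOut_pos).ne' measure_closedBall_lt_top.ne
  rw [Measure.addHaar_ball_of_pos μ z b.rOut_pos, ← Measure.addHaar_closedBall μ 0 b.rOut_pos.le,
    Real.enorm_of_nonneg (b.nonneg_normed w)]
  calc ENNReal.ofReal (b.normed μ w)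
      ≤ ENNReal.ofReal (2 ^ Module.finrank ℝ E / μ.real (closedBall (0 : E) b.rOut)) :=
        ENNReal.ofReal_le_ofReal (b.normed_le_div_measure_closedBall_rOut μ 2 hb w)
    _ = _ := by
        rw [ENNReal.ofReal_div_of_pos hpos, ofReal_measureReal measure_closedBall_lt_top.ne,
          ENNReal.ofReal_pow (by norm_num), ENNReal.ofReal_ofNat]

theorem normed_eq_zero {w : E} (hw : w ∉ ball 0 b.rOut) : b.normed μ w = 0 := by
  rwa [← Function.notMem_support, b.support_normed_eq]

theorem enorm_mollify_le_maximal (hb : b.rOut ≤ 2 * b.rIn) {x z : E} (hx : x ∈ ball z b.rOut) :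
    ‖mollify b μ g z‖ₑ ≤ 2 ^ Module.finrank ℝ E * maximal μ (fun y => ‖g y‖ₑ) x := by
  set B := ball z b.rOut
  calc ‖mollify b μ g z‖ₑ
      ≤ ∫⁻ t, ‖g t * b.normed μ (z - t)‖ₑ ∂μ := enorm_integral_le_lintegral_enorm _
    _ ≤ ∫⁻ t in B, ‖g t‖ₑ * (2 ^ Module.finrank ℝ E / μ B) ∂μ := by
        rw [← lintegral_indicator measurableSet_ball]
        refine lintegral_mono fun t => ?_
        by_cases ht : t ∈ B
        · rw [indicator_of_mem ht, enorm_mul]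
          gcongr
          exact enorm_normed_le b hb _ z
        · rw [normed_eq_zero b fun hzt => ht (by simpa [B, dist_eq_norm, norm_sub_rev] using hzt)]
          simp
    _ = (∫⁻ t in B, ‖g t‖ₑ ∂μ) * (2 ^ Module.finrank ℝ E / μ B) :=
        lintegral_mul_const' _ _ (ENNReal.div_ne_top (by simp)
          (measure_ball_pos μ z b.rOut_pos).ne')
    _ ≤ μ B * maximal μ (fun y => ‖g y‖ₑ) x * (2 ^ Module.finrank ℝ E / μ B) := by
        gcongr
        exact setLIntegral_ball_le_maximal hx
    _ = 2 ^ Module.finrank ℝ E * maximal μ (fun y => ‖g y‖ₑ) x := by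
        rw [mul_right_comm, ENNReal.mul_div_cancel (measure_ball_pos μ z b.rOut_pos).ne'
          measure_ball_lt_top.ne]

theorem setLIntegral_enorm_mollify_le (hg : AEStronglyMeasurable g μ) (S : Set E) :
    ∫⁻ z in S, ‖mollify b μ g z‖ₑ ∂μ ≤
      ∫⁻ w, ‖b.normed μ w‖ₑ * ∫⁻ z in S, ‖g (z - w)‖ₑ ∂μ ∂μ := by
  have hmeas : AEMeasurable (fun p : E × E => ‖b.normed μ p.2‖ₑ * ‖g (p.1 - p.2)‖ₑ)
      ((μ.restrict S).prod μ) :=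
    (b.continuous_normed.comp continuous_snd).enorm.aemeasurable.mul
      ((hg.comp_quasiMeasurePreserving (quasiMeasurePreserving_sub_of_right_invariant μ μ)).mono_ac
        (Measure.restrict_le_self.absolutelyContinuous.prod .rfl)).enorm
  calc ∫⁻ z in S, ‖mollify b μ g z‖ₑ ∂μ
      ≤ ∫⁻ z in S, ∫⁻ w, ‖b.normed μ w‖ₑ * ‖g (z - w)‖ₑ ∂μ ∂μ :=
        lintegral_mono fun z => enorm_mollify_le_lintegral b z
    _ = ∫⁻ w, ∫⁻ z in S, ‖b.normed μ w‖ₑ * ‖g (z - w)‖ₑ ∂μ ∂μ := lintegral_lintegral_swap hmeas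
    _ = _ := lintegral_congr fun w => lintegral_const_mul' _ _ enorm_ne_top

theorem setLIntegral_ball_mollify_le_maximal (hg : AEStronglyMeasurable g μ) (hr : b.rOut ≤ r)
    (x : E) : ∫⁻ z in ball x r, ‖mollify b μ g z‖ₑ ∂μ ≤
      μ (ball x r) * maximal μ (fun y => ‖g y‖ₑ) x := by
  calc _ ≤ ∫⁻ w, ‖b.normed μ w‖ₑ * ∫⁻ z in ball x r, ‖g (z - w)‖ₑ ∂μ ∂μ :=
        setLIntegral_enorm_mollify_le b hg _
    _ ≤ ∫⁻ w, ‖b.normed μ w‖ₑ * (μ (ball x r) * maximal μ (fun y => ‖g y‖ₑ) x) ∂μ := by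
        refine lintegral_mono fun w => ?_
        by_cases hw : w ∈ ball 0 b.rOut
        · gcongr
          rw [setLIntegral_ball_comp_sub μ (fun z => ‖g z‖ₑ), Measure.addHaar_ball_center μ x,
            ← Measure.addHaar_ball_center μ (x - w)]
          refine setLIntegral_ball_le_maximal ?_
          simpa using (mem_ball_zero_iff.1 hw).trans_le hr
        · simp [normed_eq_zero b hw]
    _ = _ := by
        rw [lintegral_mul_const _ b.continuous_normed.enorm.measurable, lintegral_enorm_normed,
          one_mul]

theorem setLIntegral_mollify_comp_add_smul_le_maximal (hg : AEStronglyMeasurable g μ)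
    (hb : b.rOut ≤ 2 * b.rIn) (x : E) (hr : 0 ≤ r) :
    ∫⁻ y in ball 0 1, ‖mollify b μ g (x + r • y)‖ₑ ∂μ ≤
      2 ^ Module.finrank ℝ E * μ (ball 0 1) * maximal μ (fun y => ‖g y‖ₑ) x := by
  set M := maximal μ (fun y => ‖g y‖ₑ) x
  rcases le_total r b.rOut with hrb | hrb
  · calc _ ≤ ∫⁻ y in ball 0 1, 2 ^ Module.finrank ℝ E * M ∂μ := by
          refine setLIntegral_mono' measurableSet_ball fun y hy => enorm_mollify_le_maximal b hb ?_
          rw [mem_ball_iff_norm', add_sub_cancel_left, norm_smul, Real.norm_of_nonneg hr]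
          exact (mul_le_mul_of_nonneg_right hrb (norm_nonneg y)).trans_lt
            (mul_lt_of_lt_one_right b.rOut_pos (mem_ball_zero_iff.1 hy))
      _ = _ := by rw [setLIntegral_const, mul_right_comm]
  · have hr0 : 0 < r := b.rOut_pos.trans_le hrb
    have hmean : ENNReal.ofReal r ^ Module.finrank ℝ E *
        ∫⁻ y in ball 0 1, ‖mollify b μ g (x + r • y)‖ₑ ∂μ ≤
          ENNReal.ofReal r ^ Module.finrank ℝ E * (μ (ball 0 1) * M) := by
      rw [setLIntegral_ball_comp_add_smul (fun z => ‖mollify b μ g z‖ₑ) x hr0, ← mul_assoc,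
        ← ENNReal.ofReal_pow hr, ← Measure.addHaar_ball_of_pos μ x hr0]
      exact setLIntegral_ball_mollify_le_maximal b hg hrb x
    rw [ENNReal.mul_le_mul_iff_right (by simp [hr0]) (by simp)] at hmean
    rw [mul_assoc]
    exact hmean.trans (le_mul_of_one_le_left' (one_le_pow₀ one_le_two))

theorem contDiff_mollify (hg : LocallyIntegrable g μ) : ContDiff ℝ ∞ (mollify b μ g) :=
  b.hasCompactSupport_normed.contDiff_convolution_right _ hg b.contDiff_normed

theorem ae_tendsto_mollify {b : ℕ → ContDiffBump (0 : E)}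
    (hb : ∀ i, (b i).rOut ≤ 2 * (b i).rIn) (hb0 : Tendsto (fun i => (b i).rOut) atTop (𝓝 0))
    (hg : LocallyIntegrable g μ) :
    ∀ᵐ x ∂μ, Tendsto (fun i => mollify (b i) μ g x) atTop (𝓝 (g x)) := by
  filter_upwards [ContDiffBump.ae_convolution_tendsto_right_of_locallyIntegrable hb0
    (Eventually.of_forall hb) hg] with x hx
  refine hx.congr fun i => ?_
  rw [mollify, convolution_lsmul_swap, convolution]
  refine integral_congr_ae (Eventually.of_forall fun t => ?_)
  simp [mul_comm]

end Mollification

section WeakGradient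

variable {n j m : ℕ} {u : EuclideanSpace ℝ (Fin n) → ℝ}

theorem HasWeakGrad.locallyIntegrable_apply
    {v : EuclideanSpace ℝ (Fin n) → EuclideanSpace ℝ (Fin m → Fin n)} (h : HasWeakGrad m u v)
    (α : Fin m → Fin n) : LocallyIntegrable (fun x => v x α) volume :=
  fun x => (h.1 x).imp fun _ hs => ⟨hs.1, (EuclideanSpace.proj (𝕜 := ℝ) α).integrable_comp hs.2⟩

theorem HasWeakGrad.iteratedFDeriv_convolution {φ : EuclideanSpace ℝ (Fin n) → ℝ}
    {v : EuclideanSpace ℝ (Fin n) → EuclideanSpace ℝ (Fin m → Fin n)} (h : HasWeakGrad m u v)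
    (hu : LocallyIntegrable u volume) (hφ : ContDiff ℝ ∞ φ) (hc : HasCompactSupport φ)
    (α : Fin m → Fin n) (x : EuclideanSpace ℝ (Fin n)) :
    iteratedFDeriv ℝ m (convolution u φ (ContinuousLinearMap.lsmul ℝ ℝ) volume) x
        (fun i => EuclideanSpace.single (α i) 1) =
      convolution (fun y => v y α) φ (ContinuousLinearMap.lsmul ℝ ℝ) volume x := by
  set e : Fin m → EuclideanSpace ℝ (Fin n) := fun i => EuclideanSpace.single (α i) 1
  have hψ : ContDiff ℝ ∞ fun t => φ (x + (-1 : ℝ) • t) := hφ.comp (by fun_prop)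
  have hψc : HasCompactSupport fun t => φ (x + (-1 : ℝ) • t) := by
    simpa [Function.comp_def, sub_eq_add_neg] using hc.comp_homeomorph (Homeomorph.subLeft x)
  have hsign : (-1 : ℝ) ^ m * (-1) ^ m = 1 := by rw [← mul_pow, neg_one_mul, neg_neg, one_pow]
  rw [GNOrlicz.iteratedFDeriv_convolution hu hφ hc]
  calc ∫ t, u t * iteratedFDeriv ℝ m φ (x - t) e
      = (-1) ^ m * ∫ t, u t * iteratedFDeriv ℝ m (fun t => φ (x + (-1 : ℝ) • t)) t e := by
        rw [← integral_const_mul]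
        refine integral_congr_ae (Eventually.of_forall fun t => ?_)
        beta_reduce
        rw [iteratedFDeriv_comp_add_smul hφ, smul_apply, smul_eq_mul, neg_one_smul,
          ← sub_eq_add_neg]
        linear_combination (-(u t * iteratedFDeriv ℝ m φ (x - t) e)) * hsign
    _ = ∫ t, v t α * φ (x - t) := by
        rw [h.2 _ hψ hψc, ← mul_assoc, hsign, one_mul]
        simp only [neg_one_smul, ← sub_eq_add_neg]

theorem norm_le_sum_norm_apply_single {ι : Type*} [Fintype ι] [DecidableEq ι]
    (f : ContinuousMultilinearMap ℝ (fun _ : Fin m => EuclideanSpace ℝ ι) ℝ) :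
    ‖f‖ ≤ ∑ β : Fin m → ι, ‖f fun i => EuclideanSpace.single (β i) (1 : ℝ)‖ := by
  refine ContinuousMultilinearMap.opNorm_le_bound (by positivity) fun w => ?_
  have hexp : w = fun i => ∑ l, w i l • EuclideanSpace.single l (1 : ℝ) := by
    ext i l
    simp [Pi.single_apply]
  conv_lhs => rw [hexp, f.map_sum]
  rw [Finset.sum_mul]
  refine norm_sum_le_of_le _ fun β _ => ?_
  rw [f.map_smul_univ, norm_smul, norm_prod, mul_comm]
  gcongr with i
  exact PiLp.norm_apply_le (w i) (β i)

theorem enorm_le_sum_enorm_apply {ι : Type*} [Fintype ι]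
    (v : EuclideanSpace ℝ ι) : ‖v‖ₑ ≤ ∑ i, ‖v i‖ₑ := by
  classical
  calc ‖v‖ₑ = ‖∑ i, v i • EuclideanSpace.single i (1 : ℝ)‖ₑ := by
        congr 1
        ext i
        simp [Pi.single_apply]
    _ ≤ ∑ i, ‖v i • EuclideanSpace.single i (1 : ℝ)‖ₑ := enorm_sum_le _ _
    _ = ∑ i, ‖v i‖ₑ := by
        refine Finset.sum_congr rfl fun i _ => ?_
        rw [enorm_smul, ← ofReal_norm (EuclideanSpace.single i (1 : ℝ)), PiLp.norm_single,
          norm_one, ENNReal.ofReal_one, mul_one]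

theorem lintegral_iteratedFDeriv_mollify_le_maximal {k : ℕ}
    {v : EuclideanSpace ℝ (Fin n) → EuclideanSpace ℝ (Fin k → Fin n)}
    (hu : LocallyIntegrable u volume) (hv : HasWeakGrad k u v)
    {b : ContDiffBump (0 : EuclideanSpace ℝ (Fin n))} (hb : b.rOut ≤ 2 * b.rIn)
    (x : EuclideanSpace ℝ (Fin n)) {r : ℝ} (hr : 0 ≤ r) :
    ∫⁻ y in ball 0 1, ‖iteratedFDeriv ℝ k (mollify b volume u) (x + r • y)‖ₑ ≤
      Fintype.card (Fin k → Fin n) * (2 ^ n * volume (ball (0 : EuclideanSpace ℝ (Fin n)) 1) *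
        maximal volume (fun y => ‖v y‖ₑ) x) := by
  have hbound : ∀ z, ‖iteratedFDeriv ℝ k (mollify b volume u) z‖ₑ ≤
      ∑ β, ‖mollify b volume (fun y => v y β) z‖ₑ := fun z => by
    have hsum := norm_le_sum_norm_apply_single (iteratedFDeriv ℝ k (mollify b volume u) z)
    simp only [mollify, hv.iteratedFDeriv_convolution hu b.contDiff_normed
      b.hasCompactSupport_normed] at hsum ⊢
    simpa only [enorm_eq_nnnorm, ← ENNReal.ofNNReal_finsetSum, ENNReal.coe_le_coe,
      ← NNReal.coe_le_coe, NNReal.coe_sum, coe_nnnorm] using hsum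
  have hcomp : ∀ β, ∫⁻ y in ball 0 1, ‖mollify b volume (fun y => v y β) (x + r • y)‖ₑ ≤
      2 ^ n * volume (ball (0 : EuclideanSpace ℝ (Fin n)) 1) *
        maximal volume (fun y => ‖v y‖ₑ) x := fun β => by
    have hmean := setLIntegral_mollify_comp_add_smul_le_maximal b
      (hv.locallyIntegrable_apply β).aestronglyMeasurable hb x hr
    rw [finrank_euclideanSpace_fin] at hmean
    refine hmean.trans ?_
    gcongr
    exact maximal_mono (fun y => enorm_le_iff_norm_le.2 (PiLp.norm_apply_le (v y) β)) x
  calc _ ≤ ∫⁻ y in ball 0 1, ∑ β, ‖mollify b volume (fun y => v y β) (x + r • y)‖ₑ :=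
        lintegral_mono fun y => hbound _
    _ = ∑ β, ∫⁻ y in ball 0 1, ‖mollify b volume (fun y => v y β) (x + r • y)‖ₑ :=
        lintegral_finsetSum _ fun β _ => (((contDiff_mollify b
          (hv.locallyIntegrable_apply β)).continuous.comp (by fun_prop)).enorm).measurable
    _ ≤ _ := (Finset.sum_le_sum fun β _ => hcomp β).trans_eq (by simp)

theorem exists_enorm_mollify_weakGrad_le (n j m : ℕ) : ∃ c : ℝ≥0,
    ∀ (u : EuclideanSpace ℝ (Fin n) → ℝ)
      (gj : EuclideanSpace ℝ (Fin n) → EuclideanSpace ℝ (Fin j → Fin n))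
      (gk : EuclideanSpace ℝ (Fin n) → EuclideanSpace ℝ (Fin (j + m) → Fin n))
      (b : ContDiffBump (0 : EuclideanSpace ℝ (Fin n))),
      LocallyIntegrable u volume → HasWeakGrad j u gj → HasWeakGrad (j + m) u gk →
      b.rOut ≤ 2 * b.rIn → ∀ x α, ∀ h : ℝ≥0, 0 < h →
      ‖mollify b volume (fun y => gj y α) x‖ₑ ≤
        c * (maximal volume (fun y => ‖u y‖ₑ) x / (h : ℝ≥0∞) ^ j +
          (h : ℝ≥0∞) ^ m * maximal volume (fun y => ‖gk y‖ₑ) x) := by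
  obtain ⟨c, hc⟩ := exists_enorm_iteratedFDeriv_apply_le
    (volume : Measure (EuclideanSpace ℝ (Fin n))) j m
  set V := 2 ^ n * volume (ball (0 : EuclideanSpace ℝ (Fin n)) 1)
  set N := ((Fintype.card (Fin (j + m) → Fin n) : ℕ) : ℝ≥0∞)
  have htop : c * ((1 + N) * V) ≠ ⊤ := by
    have hV : V ≠ ⊤ := ENNReal.mul_ne_top (by simp) measure_ball_lt_top.ne
    finiteness
  refine ⟨(c * ((1 + N) * V)).toNNReal, fun u gj gk b hu hgj hgk hb x α h hh => ?_⟩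
  rw [ENNReal.coe_toNNReal htop]
  set Mu := maximal volume (fun y => ‖u y‖ₑ) x
  set Mg := maximal volume (fun y => ‖gk y‖ₑ) x
  rw [mollify, ← hgj.iteratedFDeriv_convolution hu b.contDiff_normed b.hasCompactSupport_normed]
  calc ‖iteratedFDeriv ℝ j (mollify b volume u) x fun i => EuclideanSpace.single (α i) 1‖ₑ
      ≤ c * ((1 + N) * V * Mu / h ^ j + h ^ m * ((1 + N) * V * Mg)) := by
        refine hc _ x _ _ (contDiff_mollify b hu) (fun r hr => ?_) (fun r hr => ?_) _ (by simp) h hh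
        · have hmean := setLIntegral_mollify_comp_add_smul_le_maximal b hu.aestronglyMeasurable
            hb x hr.le
          rw [finrank_euclideanSpace_fin] at hmean
          calc _ ≤ V * Mu := hmean
            _ ≤ (1 + N) * (V * Mu) := le_mul_of_one_le_left' le_self_add
            _ = (1 + N) * V * Mu := (mul_assoc _ _ _).symm
        · refine (lintegral_iteratedFDeriv_mollify_le_maximal hu hgk hb x hr).trans ?_
          rw [← mul_assoc]
          gcongr
          exact le_add_self
    _ = c * ((1 + N) * V) * (Mu / h ^ j + h ^ m * Mg) := by
        simp only [div_eq_mul_inv]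
        ring

theorem exists_enorm_weakGrad_le (n j m : ℕ) : ∃ c : ℝ≥0,
    ∀ (u : EuclideanSpace ℝ (Fin n) → ℝ)
      (gj : EuclideanSpace ℝ (Fin n) → EuclideanSpace ℝ (Fin j → Fin n))
      (gk : EuclideanSpace ℝ (Fin n) → EuclideanSpace ℝ (Fin (j + m) → Fin n)),
      LocallyIntegrable u volume → HasWeakGrad j u gj → HasWeakGrad (j + m) u gk →
      ∀ᵐ x, ∀ h : ℝ≥0, 0 < h → ‖gj x‖ₑ ≤
        c * (maximal volume (fun y => ‖u y‖ₑ) x / (h : ℝ≥0∞) ^ j +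
          (h : ℝ≥0∞) ^ m * maximal volume (fun y => ‖gk y‖ₑ) x) := by
  obtain ⟨c, hc⟩ := exists_enorm_mollify_weakGrad_le n j m
  refine ⟨Fintype.card (Fin j → Fin n) * c, fun u gj gk hu hgj hgk => ?_⟩
  let b : ℕ → ContDiffBump (0 : EuclideanSpace ℝ (Fin n)) := fun i =>
    ⟨1 / (i + 1), 2 * (1 / (i + 1)), by positivity,
      lt_mul_of_one_lt_left (by positivity) one_lt_two⟩
  have hb : ∀ i, (b i).rOut ≤ 2 * (b i).rIn := fun i => le_rfl
  have hb0 : Tendsto (fun i => (b i).rOut) atTop (𝓝 0) := by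
    simpa only [mul_zero] using (tendsto_one_div_add_atTop_nhds_zero_nat (𝕜 := ℝ)).const_mul 2
  filter_upwards [ae_all_iff.2 fun α => ae_tendsto_mollify hb hb0 (hgj.locallyIntegrable_apply α)]
    with x hx h hh
  have hcomp : ∀ α, ‖gj x α‖ₑ ≤ c * (maximal volume (fun y => ‖u y‖ₑ) x / (h : ℝ≥0∞) ^ j +
      (h : ℝ≥0∞) ^ m * maximal volume (fun y => ‖gk y‖ₑ) x) := fun α =>
    le_of_tendsto (hx α).enorm
      (Eventually.of_forall fun i => hc u gj gk (b i) hu hgj hgk (hb i) x α h hh)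
  calc ‖gj x‖ₑ ≤ ∑ α, ‖gj x α‖ₑ := enorm_le_sum_enorm_apply _
    _ ≤ _ := Finset.sum_le_sum fun α _ => hcomp α
    _ = _ := by
        rw [Finset.sum_const, Finset.card_univ, nsmul_eq_mul]
        push_cast
        ring

end WeakGradient

/-! ### Interpolation -/

section Interpolation

variable {j m : ℕ} {κ θ : ℝ}

theorem exists_div_pow_eq_and_pow_mul_eq (hκ : κ ≠ 0) (hj : θ * κ = j) (hm : (1 - θ) * κ = m)
    {p q : ℝ≥0} (hp : 0 < p) (hq : 0 < q) :
    ∃ r : ℝ≥0, 0 < r ∧ p / r ^ j = q ^ θ * p ^ (1 - θ) ∧ r ^ m * q = q ^ θ * p ^ (1 - θ) := by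
  have hpow : ∀ {i : ℕ} {η : ℝ}, η * κ = i → ((p / q) ^ κ⁻¹) ^ i = (p / q) ^ η := fun hi => by
    rw [← NNReal.rpow_natCast, ← NNReal.rpow_mul, ← hi, mul_comm, mul_inv_cancel_right₀ hκ]
  refine ⟨(p / q) ^ κ⁻¹, NNReal.rpow_pos (div_pos hp hq), ?_, ?_⟩
  · have := (NNReal.rpow_pos (p := θ) hp).ne'
    have := (NNReal.rpow_pos (p := θ) hq).ne'
    rw [hpow hj, NNReal.div_rpow, NNReal.rpow_sub hp.ne', NNReal.rpow_one]
    field_simp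
  · have := (NNReal.rpow_pos (p := θ) hq).ne'
    rw [hpow hm, NNReal.div_rpow, NNReal.rpow_sub hq.ne', NNReal.rpow_one]
    field_simp

theorem le_two_mul_rpow_mul_rpow (hκ : κ ≠ 0) (hj : θ * κ = j) (hm : (1 - θ) * κ = m)
    {G X Y : ℝ≥0∞} {c p q : ℝ≥0} (hp : 0 < p) (hq : 0 < q) (hX : X ≤ p) (hY : Y ≤ q)
    (h : ∀ r : ℝ≥0, 0 < r → G ≤ c * (X / (r : ℝ≥0∞) ^ j + (r : ℝ≥0∞) ^ m * Y)) :
    G ≤ (2 * c * (q ^ θ * p ^ (1 - θ)) : ℝ≥0) := by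
  obtain ⟨r, hr, hrj, hrm⟩ := exists_div_pow_eq_and_pow_mul_eq hκ hj hm hp hq
  calc G ≤ c * (X / (r : ℝ≥0∞) ^ j + (r : ℝ≥0∞) ^ m * Y) := h r hr
    _ ≤ c * (p / (r : ℝ≥0∞) ^ j + (r : ℝ≥0∞) ^ m * q) := by gcongr
    _ = (c * (p / r ^ j + r ^ m * q) : ℝ≥0) := by
        push_cast [ENNReal.coe_div (pow_pos hr j).ne']
        rfl
    _ = _ := by
        rw [hrj, hrm]
        congr 1
        ring

variable {A B C : ℝ≥0 → ℝ≥0} {c K : ℝ≥0}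

theorem IsYoung.extend_div_le_add (hA : IsYoung A) (hB : IsYoung B) (hC : IsYoung C)
    (hκ : κ ≠ 0) (hj : θ * κ = j) (hm : (1 - θ) * κ = m)
    (hK : ∀ t : ℝ≥0, 0 < t → inverse B t ^ θ * inverse C t ^ (1 - θ) ≤ K * inverse A t)
    {β γ : ℝ≥0} (hβ : 0 < β) (hγ : 0 < γ) {G X Y : ℝ≥0∞}
    (h : ∀ r : ℝ≥0, 0 < r → G ≤ c * (X / (r : ℝ≥0∞) ^ j + (r : ℝ≥0∞) ^ m * Y)) :
    extend A (G / ((2 * c * K * (β ^ θ * γ ^ (1 - θ)) : ℝ≥0) : ℝ≥0∞)) ≤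
      extend B (Y / β) + extend C (X / γ) := by
  refine le_of_forall_gt_imp_ge_of_dense fun t ht => ?_
  induction t with
  | top => exact le_top
  | coe t =>
    have ht0 : 0 < t := by exact_mod_cast zero_le.trans_lt ht
    have hY : Y ≤ (β * inverse B t : ℝ≥0) := by
      rw [ENNReal.coe_mul, ← ENNReal.div_le_iff' (by simpa using hβ.ne') ENNReal.coe_ne_top,
        ← hB.extend_le_coe_iff]
      exact le_self_add.trans ht.le
    have hX : X ≤ (γ * inverse C t : ℝ≥0) := by
      rw [ENNReal.coe_mul, ← ENNReal.div_le_iff' (by simpa using hγ.ne') ENNReal.coe_ne_top,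
        ← hC.extend_le_coe_iff]
      exact le_add_self.trans ht.le
    rw [hA.extend_le_coe_iff]
    refine ENNReal.div_le_of_le_mul' ?_
    rw [← ENNReal.coe_mul]
    refine (le_two_mul_rpow_mul_rpow hκ hj hm (mul_pos hγ (hC.inverse_pos ht0))
      (mul_pos hβ (hB.inverse_pos ht0)) hX hY h).trans (ENNReal.coe_le_coe.2 ?_)
    calc 2 * c * ((β * inverse B t) ^ θ * (γ * inverse C t) ^ (1 - θ))
        = 2 * c * (β ^ θ * γ ^ (1 - θ)) * (inverse B t ^ θ * inverse C t ^ (1 - θ)) := by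
          rw [NNReal.mul_rpow, NNReal.mul_rpow]
          ring
      _ ≤ 2 * c * (β ^ θ * γ ^ (1 - θ)) * (K * inverse A t) := by
          exact mul_le_mul_right (hK t ht0) _
      _ = 2 * c * K * (β ^ θ * γ ^ (1 - θ)) * inverse A t := by ring

theorem le_mul_rpow_mul_rpow_of_forall_lt {p q : ℝ} (hp : 0 ≤ p) (hq : 0 ≤ q) {Z a b : ℝ≥0∞}
    (ha : a ≠ ⊤) (hb : b ≠ ⊤)
    (h : ∀ β γ : ℝ≥0, a < β → b < γ → Z ≤ (K * (β ^ p * γ ^ q) : ℝ≥0)) :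
    Z ≤ K * (a ^ p * b ^ q) := by
  lift a to ℝ≥0 using ha
  lift b to ℝ≥0 using hb
  have hcont : Continuous fun ε : ℝ≥0 => ((K * ((a + ε) ^ p * (b + ε) ^ q) : ℝ≥0) : ℝ≥0∞) :=
    ENNReal.continuous_coe.comp (continuous_const.mul
      (((NNReal.continuous_rpow_const hp).comp (continuous_const_add a)).mul
        ((NNReal.continuous_rpow_const hq).comp (continuous_const_add b))))
  have hlim := (hcont.tendsto 0).mono_left (nhdsWithin_le_nhds (s := Ioi 0))
  simp only [add_zero, ENNReal.coe_mul, ENNReal.coe_rpow_of_nonneg _ hp,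
    ENNReal.coe_rpow_of_nonneg _ hq] at hlim
  refine ge_of_tendsto hlim ?_
  filter_upwards [self_mem_nhdsWithin] with ε hε
  simpa only [ENNReal.coe_mul, ENNReal.coe_rpow_of_nonneg _ hp, ENNReal.coe_rpow_of_nonneg _ hq]
    using h _ _ (ENNReal.coe_lt_coe.2 (lt_add_of_pos_right a hε))
      (ENNReal.coe_lt_coe.2 (lt_add_of_pos_right b hε))

theorem IsYoung.luxemburg_le_mul_rpow_mul_rpow (hA : IsYoung A) (hB : IsYoung B) (hC : IsYoung C)
    (hκ : 0 < κ) (hj : θ * κ = j) (hm : (1 - θ) * κ = m) (hc0 : 0 < c) (hK0 : 0 < K)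
    (hK : ∀ t : ℝ≥0, 0 < t → inverse B t ^ θ * inverse C t ^ (1 - θ) ≤ K * inverse A t)
    {α : Type*} [MeasurableSpace α] {μ : Measure α} {G X Y : α → ℝ≥0∞} (hYm : AEMeasurable Y μ)
    (h : ∀ᵐ x ∂μ, ∀ r : ℝ≥0, 0 < r → G x ≤ c * (X x / (r : ℝ≥0∞) ^ j + (r : ℝ≥0∞) ^ m * Y x))
    (hY : luxemburg B μ Y ≠ ⊤) (hX : luxemburg C μ X ≠ ⊤) :
    luxemburg A μ G ≤
      (2 * (2 * c * K) : ℝ≥0) * (luxemburg B μ Y ^ θ * luxemburg C μ X ^ (1 - θ)) := by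
  have hθ : 0 ≤ θ := nonneg_of_mul_nonneg_left (hj.symm ▸ j.cast_nonneg) hκ
  have hθ' : 0 ≤ 1 - θ := nonneg_of_mul_nonneg_left (hm.symm ▸ m.cast_nonneg) hκ
  refine le_mul_rpow_mul_rpow_of_forall_lt hθ hθ' hY hX fun β γ hβ hγ => ?_
  have hβ0 : 0 < β := by exact_mod_cast zero_le.trans_lt hβ
  have hγ0 : 0 < γ := by exact_mod_cast zero_le.trans_lt hγ
  have hmod : modular A μ (fun x => G x / ((2 * c * K * (β ^ θ * γ ^ (1 - θ)) : ℝ≥0) : ℝ≥0∞)) ≤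
      (2 : ℝ≥0) := by
    calc _ ≤ ∫⁻ x, (extend B (Y x / β) + extend C (X x / γ)) ∂μ := lintegral_mono_ae
          (h.mono fun x hx => hA.extend_div_le_add hB hC hκ.ne' hj hm hK hβ0 hγ0 hx)
      _ = modular B μ (fun x => Y x / β) + modular C μ (fun x => X x / γ) :=
          lintegral_add_left' (hB.measurable_extend.comp_aemeasurable (hYm.div_const _)) _
      _ ≤ 1 + 1 := add_le_add (hB.modular_le_one_of_luxemburg_lt hβ)
          (hC.modular_le_one_of_luxemburg_lt hγ)
      _ = _ := by norm_num
  have := NNReal.rpow_pos (p := θ) hβ0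
  have := NNReal.rpow_pos (p := 1 - θ) hγ0
  rw [mul_assoc]
  exact hA.luxemburg_le_of_modular_le (by positivity) one_le_two hmod

theorem HasWeakGrad.ae_eq_zero {n m : ℕ} {u : EuclideanSpace ℝ (Fin n) → ℝ}
    {v : EuclideanSpace ℝ (Fin n) → EuclideanSpace ℝ (Fin m → Fin n)} (h : HasWeakGrad m u v)
    (hu : u =ᵐ[volume] 0) : v =ᵐ[volume] 0 := by
  have hcomp : ∀ α, ∀ᵐ x, v x α = 0 := fun α => by
    refine ae_eq_zero_of_integral_contDiff_smul_eq_zero (h.locallyIntegrable_apply α)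
      fun φ hφ hc => ?_
    have hint := h.2 φ hφ hc α
    rw [integral_eq_zero_of_ae (hu.mono fun x hx => by simp [hx]), eq_comm, mul_eq_zero] at hint
    simpa [mul_comm] using hint.resolve_left (by simp)
  filter_upwards [ae_all_iff.2 hcomp] with x hx
  ext α
  exact hx α

theorem IsYoung.luxemburg_weakGrad_eq_zero {n m : ℕ} (hA : IsYoung A) (hC : IsYoung C)
    {u : EuclideanSpace ℝ (Fin n) → ℝ}
    {v : EuclideanSpace ℝ (Fin n) → EuclideanSpace ℝ (Fin m → Fin n)}
    (hu : AEMeasurable u) (hv : HasWeakGrad m u v)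
    (h0 : luxemburg C volume (maximal volume fun x => ‖u x‖ₑ) = 0) :
    luxemburg A volume (fun x => ‖v x‖ₑ) = 0 := by
  have hM : maximal volume (fun x => ‖u x‖ₑ) =ᵐ[volume] 0 :=
    (hC.luxemburg_eq_zero_iff (measurable_maximal _ _).aemeasurable).1 h0
  obtain ⟨x, hx⟩ := hM.exists
  have hu0 : u =ᵐ[volume] 0 :=
    (ae_eq_zero_of_maximal_eq_zero hu.enorm hx).mono fun y hy => by simpa using hy
  exact hA.luxemburg_eq_zero_of_ae_eq_zero ((hv.ae_eq_zero hu0).mono fun y hy => by simp [hy])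

theorem rpow_mul_rpow_eq_top {a b : ℝ≥0∞} {p q : ℝ} (hp : 0 < p) (hq : 0 < q)
    (hab : a ≠ 0 ∨ b ≠ ⊤) (hb0 : b ≠ 0) (htop : a = ⊤ ∨ b = ⊤) : a ^ p * b ^ q = ⊤ := by
  rw [ENNReal.mul_eq_top]
  rcases htop with ha | hb
  · exact Or.inr ⟨by rw [ha, ENNReal.top_rpow_of_pos hp], by simp [hb0, hq.not_gt]⟩
  · exact Or.inl ⟨by simp [hab.resolve_right (not_not.2 hb), hp.not_gt],
      by rw [hb, ENNReal.top_rpow_of_pos hq]⟩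

theorem exists_luxemburg_weakGrad_le_maximal {n j k : ℕ} (hk : 0 < k) (hjk : j ≤ k)
    (hA : IsYoung A) (hB : IsYoung B) (hC : IsYoung C) (hcond : InverseCondition j k A B C) :
    ∃ L : ℝ≥0, ∀ (u : EuclideanSpace ℝ (Fin n) → ℝ) gj gk, LocallyIntegrable u volume →
      HasWeakGrad j u gj → HasWeakGrad k u gk →
      luxemburg B volume (maximal volume fun x => ‖gk x‖ₑ) ≠ ⊤ →
      luxemburg C volume (maximal volume fun x => ‖u x‖ₑ) ≠ ⊤ →
      luxemburg A volume (fun x => ‖gj x‖ₑ) ≤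
        L * (luxemburg B volume (maximal volume fun x => ‖gk x‖ₑ) ^ ((j : ℝ) / k) *
          luxemburg C volume (maximal volume fun x => ‖u x‖ₑ) ^ (1 - (j : ℝ) / k)) := by
  obtain ⟨m, rfl⟩ := Nat.exists_eq_add_of_le hjk
  obtain ⟨K, hK⟩ := hcond
  obtain ⟨c, hc⟩ := exists_enorm_weakGrad_le n j m
  have hκ : (0 : ℝ) < (j + m : ℕ) := by exact_mod_cast hk
  have hθj : (j : ℝ) / (j + m : ℕ) * (j + m : ℕ) = j := div_mul_cancel₀ _ hκ.ne'
  have hθm : (1 - (j : ℝ) / (j + m : ℕ)) * (j + m : ℕ) = m := by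
    rw [sub_mul, hθj]
    push_cast
    ring
  refine ⟨2 * (2 * (c + 1) * (K + 1)), fun u gj gk hu hgj hgk hB' hC' => ?_⟩
  refine hA.luxemburg_le_mul_rpow_mul_rpow hB hC hκ hθj hθm (by positivity) (by positivity)
    (fun t ht => (hK t ht).trans (mul_le_mul_left le_self_add _))
    (measurable_maximal _ _).aemeasurable ?_ hB' hC'
  filter_upwards [hc u gj gk hu hgj hgk] with x hx r hr
  refine (hx r hr).trans ?_
  gcongr
  exact le_self_add

theorem exists_luxemburg_weakGrad_le {n j k : ℕ} (hj : 1 ≤ j) (hjk : j < k) (hA : IsYoung A)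
    (hB : IsYoung B) (hC : IsYoung C) (hcond : InverseCondition j k A B C)
    {X Y : (EuclideanSpace ℝ (Fin n) → ℝ≥0∞) → ℝ≥0∞} {K₁ K₂ : ℝ≥0}
    (hX : ∀ f, AEMeasurable f → luxemburg B volume (maximal volume f) ≤ K₁ * X f)
    (hY : ∀ f, AEMeasurable f → luxemburg C volume (maximal volume f) ≤ K₂ * Y f) :
    ∃ K : ℝ≥0, ∀ u : EuclideanSpace ℝ (Fin n) → ℝ, WeaklyDifferentiable k u →
      ∀ gj gk, HasWeakGrad j u gj → HasWeakGrad k u gk →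
        (X (fun x => ‖gk x‖ₑ) ≠ 0 ∨ Y (fun x => ‖u x‖ₑ) ≠ ⊤) →
        luxemburg A volume (fun x => ‖gj x‖ₑ) ≤ K * (X (fun x => ‖gk x‖ₑ) ^ ((j : ℝ) / k) *
          Y (fun x => ‖u x‖ₑ) ^ (1 - (j : ℝ) / k)) := by
  obtain ⟨L, hL⟩ :=
    exists_luxemburg_weakGrad_le_maximal (n := n) (by lia) hjk.le hA hB hC hcond
  have hk : (0 : ℝ) < k := by exact_mod_cast (by lia : 0 < k)
  set θ : ℝ := (j : ℝ) / k
  have hθ : 0 < θ := div_pos (by exact_mod_cast hj) hk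
  have hθ' : 0 < 1 - θ := sub_pos.2 ((div_lt_one hk).2 (by exact_mod_cast hjk))
  refine ⟨L * (K₁ ^ θ * K₂ ^ (1 - θ)) + 1, fun u hu gj gk hgj hgk hXY => ?_⟩
  have hum : AEMeasurable u := hu.1.aestronglyMeasurable.aemeasurable
  have hMg := hX _ hgk.1.aestronglyMeasurable.enorm
  have hMu := hY _ hum.enorm
  set a := X fun x => ‖gk x‖ₑ
  set b := Y fun x => ‖u x‖ₑ
  rcases eq_or_ne b 0 with hb0 | hb0
  · rw [hA.luxemburg_weakGrad_eq_zero hC hum hgj (by simpa [hb0] using hMu)]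
    exact zero_le
  by_cases htop : a = ⊤ ∨ b = ⊤
  · rw [rpow_mul_rpow_eq_top hθ hθ' hXY hb0 htop, ENNReal.mul_top (by simp)]
    exact le_top
  · push Not at htop
    have hg := ne_top_of_le_ne_top (ENNReal.mul_ne_top ENNReal.coe_ne_top htop.1) hMg
    have hf := ne_top_of_le_ne_top (ENNReal.mul_ne_top ENNReal.coe_ne_top htop.2) hMu
    calc luxemburg A volume (fun x => ‖gj x‖ₑ)
        ≤ L * (luxemburg B volume (maximal volume fun x => ‖gk x‖ₑ) ^ θ *
            luxemburg C volume (maximal volume fun x => ‖u x‖ₑ) ^ (1 - θ)) :=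
          hL u gj gk hu.1 hgj hgk hg hf
      _ ≤ L * ((K₁ * a) ^ θ * (K₂ * b) ^ (1 - θ)) := by gcongr
      _ = (L * (K₁ ^ θ * K₂ ^ (1 - θ)) : ℝ≥0) * (a ^ θ * b ^ (1 - θ)) := by
          rw [ENNReal.mul_rpow_of_nonneg _ _ hθ.le, ENNReal.mul_rpow_of_nonneg _ _ hθ'.le,
            ENNReal.coe_mul, ENNReal.coe_mul, ENNReal.coe_rpow_of_nonneg _ hθ.le,
            ENNReal.coe_rpow_of_nonneg _ hθ'.le]
          ring
      _ ≤ _ := by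
          gcongr
          exact le_self_add

theorem maximalInequality_of_inverseCondition {n j k : ℕ} (hn : 1 ≤ n) (hj : 1 ≤ j) (hjk : j < k)
    (hA : IsYoung A) (hB : IsYoung B) (hC : IsYoung C) (hcond : InverseCondition j k A B C) :
    MaximalInequality n j k A B C := by
  have : Nonempty (Fin n) := Fin.pos_iff_nonempty.1 hn
  exact exists_luxemburg_weakGrad_le hj hjk hA hB hC hcond
    (X := fun f => luxemburg B halfLine (maxRearr volume f))
    (Y := fun f => luxemburg C halfLine (maxRearr volume f))
    (fun f hf => hB.luxemburg_maximal_le_maxRearr hf)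
    (fun f hf => hC.luxemburg_maximal_le_maxRearr hf)

theorem plainInequality_of_inverseCondition {n j k : ℕ} (hn : 1 ≤ n) (hj : 1 ≤ j) (hjk : j < k)
    (hA : IsYoung A) (hB : IsYoung B) (hC : IsYoung C) (hcond : InverseCondition j k A B C)
    (hBi : upperBoydIndex B < 1) (hCi : upperBoydIndex C < 1) : PlainInequality n j k A B C := by
  have : Nonempty (Fin n) := Fin.pos_iff_nonempty.1 hn
  obtain ⟨K₁, hK₁⟩ := hB.exists_luxemburg_maximal_le_of_upperBoydIndex_lt hBi
    (volume : Measure (EuclideanSpace ℝ (Fin n)))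
  obtain ⟨K₂, hK₂⟩ := hC.exists_luxemburg_maximal_le_of_upperBoydIndex_lt hCi
    (volume : Measure (EuclideanSpace ℝ (Fin n)))
  exact exists_luxemburg_weakGrad_le hj hjk hA hB hC hcond hK₁ hK₂

end Interpolation

/-! ### Necessity of (1) -/

section Necessity

variable {A B C : ℝ≥0 → ℝ≥0}

theorem measure_preimage_smul_mul_pow {E : Type*} [NormedAddCommGroup E] [NormedSpace ℝ E]
    [FiniteDimensional ℝ E] [MeasurableSpace E] [BorelSpace E] (μ : Measure E)
    [μ.IsAddHaarMeasure] {a : ℝ≥0} (ha : 0 < a) (S : Set E) :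
    μ ((fun x => (a : ℝ) • x) ⁻¹' S) * (a ^ Module.finrank ℝ E : ℝ≥0) = μ S := by
  have hpow : 0 < a ^ Module.finrank ℝ E := pow_pos ha _
  rw [Measure.addHaar_preimage_smul _ (by exact_mod_cast ha.ne'), abs_of_nonneg (by positivity),
    ← NNReal.coe_pow, ← NNReal.coe_inv, ENNReal.ofReal_coe_nnreal, mul_right_comm,
    ← ENNReal.coe_mul, inv_mul_cancel₀ hpow.ne', ENNReal.coe_one, one_mul]

section Dilation

variable {E F : Type*} [NormedAddCommGroup E] [NormedSpace ℝ E] [FiniteDimensional ℝ E]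
  [MeasurableSpace E] [BorelSpace E] (μ : Measure E) [μ.IsAddHaarMeasure]
  [NormedAddCommGroup F] {w : E → F}

theorem exists_luxemburg_comp_smul_le (hw : Continuous w) (hc : HasCompactSupport w) :
    ∃ W : ℝ≥0, ∀ A, IsYoung A → ∀ a : ℝ≥0, 0 < a →
      luxemburg A μ (fun x => ‖w ((a : ℝ) • x)‖ₑ) ≤
        (W / inverse A (a ^ Module.finrank ℝ E) : ℝ≥0) := by
  obtain ⟨M, hM⟩ := hc.exists_bound_of_continuous hw
  have hs : ∀ x, ‖w x‖₊ ≤ M.toNNReal := fun x => (hM x).trans (Real.le_coe_toNNReal M)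
  set s : ℝ≥0 := M.toNNReal + 1
  set v : ℝ≥0 := (μ (tsupport w)).toNNReal + 1
  have hv : μ (tsupport w) ≤ v := by
    rw [ENNReal.coe_add, ENNReal.coe_toNNReal hc.measure_lt_top.ne]
    exact le_self_add
  refine ⟨s * v, fun A hA a ha => ?_⟩
  set d := Module.finrank ℝ E
  have had : 0 < a ^ d / v := by positivity
  have hS : MeasurableSet ((fun x => (a : ℝ) • x) ⁻¹' tsupport w) :=
    measurable_const_smul (a : ℝ) (isClosed_tsupport w).measurableSet
  calc luxemburg A μ (fun x => ‖w ((a : ℝ) • x)‖ₑ)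
      ≤ luxemburg A μ (((fun x => (a : ℝ) • x) ⁻¹' tsupport w).indicator fun _ => (s : ℝ≥0∞)) := by
        refine hA.luxemburg_mono fun x => ?_
        by_cases hx : (a : ℝ) • x ∈ tsupport w
        · rw [indicator_of_mem (mem_preimage.2 hx)]
          exact ENNReal.coe_le_coe.2 ((hs _).trans le_self_add)
        · simp [image_eq_zero_of_notMem_tsupport hx]
    _ ≤ (s / inverse A (a ^ d / v) : ℝ≥0) := by
        refine hA.luxemburg_indicator_le hS (by positivity) had ?_
        rw [ENNReal.coe_div (by positivity), ← mul_div_assoc, measure_preimage_smul_mul_pow μ ha]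
        exact ENNReal.div_le_of_le_mul (by rwa [one_mul])
    _ ≤ (s * v / inverse A (a ^ d) : ℝ≥0) := by
        have hinv := hA.inverse_mul_le (c := v) le_add_self (a ^ d / v)
        rw [mul_div_cancel₀ _ (by positivity)] at hinv
        rw [ENNReal.coe_le_coe, div_le_div_iff₀ (hA.inverse_pos had)
          (hA.inverse_pos (by positivity)), mul_assoc]
        gcongr

theorem exists_le_luxemburg_comp_smul (hw : Continuous w) (hw0 : ∃ x, w x ≠ 0) :
    ∃ δ : ℝ≥0, 0 < δ ∧ ∀ A, IsYoung A → ∀ a : ℝ≥0, 0 < a →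
      (δ / inverse A (a ^ Module.finrank ℝ E) : ℝ≥0) ≤
        luxemburg A μ (fun x => ‖w ((a : ℝ) • x)‖ₑ) := by
  obtain ⟨x₀, hx₀⟩ := hw0
  obtain ⟨s, hs, hsx⟩ := exists_between (nnnorm_pos.2 hx₀)
  have hopen : IsOpen {x | s < ‖w x‖₊} := isOpen_lt continuous_const hw.nnnorm
  obtain ⟨o, ho, ho_lt⟩ := ENNReal.lt_iff_exists_nnreal_btwn.1
    (lt_min (hopen.measure_pos μ ⟨x₀, hsx⟩) one_pos)
  have ho0 : 0 < o := by exact_mod_cast ho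
  have ho1 : o ≤ 1 := by exact_mod_cast (ho_lt.trans_le (min_le_right _ _)).le
  refine ⟨s * o, mul_pos hs ho0, fun A hA a ha => ?_⟩
  set d := Module.finrank ℝ E
  have had : 0 < a ^ d / o := by positivity
  have hS : MeasurableSet ((fun x => (a : ℝ) • x) ⁻¹' {x | s < ‖w x‖₊}) :=
    measurable_const_smul (a : ℝ) hopen.measurableSet
  calc ((s * o / inverse A (a ^ d) : ℝ≥0) : ℝ≥0∞)
      ≤ (s / inverse A (a ^ d / o) : ℝ≥0) := by
        have hinv := hA.inverse_mul_le (one_le_inv₀ ho0 |>.2 ho1) (a ^ d)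
        rw [← div_eq_inv_mul, ← div_eq_inv_mul, le_div_iff₀' ho0] at hinv
        rw [ENNReal.coe_le_coe, div_le_div_iff₀ (hA.inverse_pos (by positivity))
          (hA.inverse_pos had), mul_assoc]
        gcongr
    _ ≤ luxemburg A μ
          (((fun x => (a : ℝ) • x) ⁻¹' {x | s < ‖w x‖₊}).indicator fun _ => (s : ℝ≥0∞)) := by
        refine hA.le_luxemburg_indicator hS had ?_
        rw [ENNReal.coe_div ho0.ne', ← mul_div_assoc, measure_preimage_smul_mul_pow μ ha,
          ENNReal.le_div_iff_mul_le (by simp [ho0.ne']) (by simp), one_mul]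
        exact (ho_lt.trans_le (min_le_left _ _)).le
    _ ≤ luxemburg A μ (fun x => ‖w ((a : ℝ) • x)‖ₑ) :=
        hA.luxemburg_mono (indicator_le fun x hx => ENNReal.coe_le_coe.2 (le_of_lt hx))

end Dilation

/-- The gradient `∇ᵐ u` of a smooth function, with the components and the norm of the weak
gradients of `HasWeakGrad`. -/
def classicalGrad {n : ℕ} (m : ℕ) (u : EuclideanSpace ℝ (Fin n) → ℝ)
    (x : EuclideanSpace ℝ (Fin n)) : EuclideanSpace ℝ (Fin m → Fin n) :=
  WithLp.toLp 2 fun α => iteratedFDeriv ℝ m u x fun i => EuclideanSpace.single (α i) (1 : ℝ)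

variable {n j k m : ℕ} {u : EuclideanSpace ℝ (Fin n) → ℝ}

theorem continuous_classicalGrad (hu : ContDiff ℝ ∞ u) : Continuous (classicalGrad m u) :=
  (PiLp.continuous_toLp 2 _).comp
    (continuous_pi fun _ => (contDiff_iteratedFDeriv_apply hu m _).continuous)

theorem hasWeakGrad_classicalGrad (hu : ContDiff ℝ ∞ u) : HasWeakGrad m u (classicalGrad m u) :=
  ⟨(continuous_classicalGrad hu).locallyIntegrable,
    fun _ hφ hc _ => integral_iteratedFDeriv_mul hu hφ hc m _⟩

theorem classicalGrad_comp_smul (hu : ContDiff ℝ ∞ u) (a : ℝ) (x : EuclideanSpace ℝ (Fin n)) :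
    classicalGrad m (fun y => u (a • y)) x = a ^ m • classicalGrad m u (a • x) := by
  ext α
  simpa [classicalGrad] using congrArg (fun f => f fun i => EuclideanSpace.single (α i) (1 : ℝ))
    (iteratedFDeriv_comp_add_smul hu m 0 a x)

theorem IsYoung.luxemburg_classicalGrad_comp_smul (hA : IsYoung A) (hu : ContDiff ℝ ∞ u) {a : ℝ≥0}
    (ha : 0 < a) :
    luxemburg A volume (fun x => ‖classicalGrad m (fun y => u ((a : ℝ) • y)) x‖ₑ) =
      (a ^ m : ℝ≥0) * luxemburg A volume (fun x => ‖classicalGrad m u ((a : ℝ) • x)‖ₑ) := by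
  rw [← hA.luxemburg_const_mul (pow_pos ha m)]
  congr 1
  ext x
  rw [classicalGrad_comp_smul hu, enorm_smul, enorm_pow]
  simp

theorem hasCompactSupport_classicalGrad (hc : HasCompactSupport u) :
    HasCompactSupport (classicalGrad m u) :=
  (hc.iteratedFDeriv m).comp_left (g := fun f : ContinuousMultilinearMap ℝ
    (fun _ : Fin m => EuclideanSpace ℝ (Fin n)) ℝ => WithLp.toLp 2 fun α : Fin m → Fin n =>
      f fun i => EuclideanSpace.single (α i) (1 : ℝ)) rfl

theorem eq_zero_of_iteratedFDeriv_eq_zero {E : Type*} [NormedAddCommGroup E] [NormedSpace ℝ E]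
    [NoncompactSpace E] {u : E → ℝ} (hu : ContDiff ℝ ∞ u) (hc : HasCompactSupport u)
    (h : iteratedFDeriv ℝ m u = 0) : u = 0 := by
  induction m with
  | zero => ext x; simpa using DFunLike.congr_fun (congrFun h x) 0
  | succ m ih =>
    have hd : Differentiable ℝ (iteratedFDeriv ℝ m u) :=
      hu.differentiable_iteratedFDeriv (by exact_mod_cast ENat.natCast_lt_top m)
    have hconst := is_const_of_fderiv_eq_zero hd fun y => by
      rw [← norm_eq_zero, norm_fderiv_iteratedFDeriv, h, Pi.zero_apply, norm_zero]
    obtain ⟨z, hz⟩ :=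
      (ne_univ_iff_exists_notMem _).1 (hc.iteratedFDeriv (𝕜 := ℝ) m).isCompact.ne_univ
    exact ih (funext fun x => (hconst x z).trans (image_eq_zero_of_notMem_tsupport hz))

theorem exists_classicalGrad_ne_zero [Nonempty (Fin n)] (hu : ContDiff ℝ ∞ u)
    (hc : HasCompactSupport u) (h0 : u ≠ 0) : ∃ x, classicalGrad m u x ≠ 0 := by
  by_contra! hcon
  have : NoncompactSpace (EuclideanSpace ℝ (Fin n)) := NormedSpace.noncompactSpace ℝ _
  refine h0 (eq_zero_of_iteratedFDeriv_eq_zero (m := m) hu hc (funext fun y => ?_))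
  refine ContinuousMultilinearMap.toMultilinearMap_injective <| Module.Basis.ext_multilinear
    (fun _ => (EuclideanSpace.basisFun (Fin n) ℝ).toBasis) fun α => ?_
  simpa [classicalGrad] using congrArg (fun v : EuclideanSpace ℝ (Fin m → Fin n) => v α) (hcon y)

theorem rpow_mul_rpow_le_of_dilation_le {δ K W₀ W₁ r p q s : ℝ≥0} {θ : ℝ} (hδ : 0 < δ)
    (hr : 0 < r) (hp : 0 < p) (hq : 0 < q) (hs : 0 < s)
    (h : r ^ θ * (δ / s) ≤ K * ((r * (W₁ / p)) ^ θ * (W₀ / q) ^ (1 - θ))) :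
    p ^ θ * q ^ (1 - θ) ≤ K * (W₁ ^ θ * W₀ ^ (1 - θ)) / δ * s := by
  have := NNReal.rpow_pos (p := θ) hp
  have := NNReal.rpow_pos (p := 1 - θ) hq
  have hcancel : δ / s ≤ K * (W₁ ^ θ * W₀ ^ (1 - θ)) / (p ^ θ * q ^ (1 - θ)) := by
    refine le_of_mul_le_mul_left (h.trans_eq ?_) (NNReal.rpow_pos (p := θ) hr)
    rw [NNReal.mul_rpow, NNReal.div_rpow, NNReal.div_rpow]
    field_simp
  rw [div_le_div_iff₀ hs (by positivity)] at hcancel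
  rwa [div_mul_eq_mul_div, le_div_iff₀' hδ]

theorem exists_contDiff_luxemburg_comp_smul_bounds [Nonempty (Fin n)] (j k : ℕ) :
    ∃ (w : EuclideanSpace ℝ (Fin n) → ℝ) (W₀ W₁ δ : ℝ≥0), ContDiff ℝ ∞ w ∧ 0 < δ ∧
      ∀ A, IsYoung A → ∀ a : ℝ≥0, 0 < a →
        luxemburg A volume (fun x => ‖w ((a : ℝ) • x)‖ₑ) ≤ (W₀ / inverse A (a ^ n) : ℝ≥0) ∧
        luxemburg A volume (fun x => ‖classicalGrad k (fun y => w ((a : ℝ) • y)) x‖ₑ) ≤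
          (a ^ k * (W₁ / inverse A (a ^ n)) : ℝ≥0) ∧
        (a ^ j * (δ / inverse A (a ^ n)) : ℝ≥0) ≤
          luxemburg A volume (fun x => ‖classicalGrad j (fun y => w ((a : ℝ) • y)) x‖ₑ) := by
  let b : ContDiffBump (0 : EuclideanSpace ℝ (Fin n)) := ⟨1 / 2, 1, by norm_num, by norm_num⟩
  have hw : ContDiff ℝ ∞ b := b.contDiff
  have hb0 : (b : EuclideanSpace ℝ (Fin n) → ℝ) ≠ 0 := fun h0 => one_ne_zero
    ((b.one_of_mem_closedBall (mem_closedBall_self b.rIn_pos.le)).symm.trans (congrFun h0 0))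
  obtain ⟨W₀, hW₀⟩ := exists_luxemburg_comp_smul_le volume b.continuous b.hasCompactSupport
  obtain ⟨W₁, hW₁⟩ := exists_luxemburg_comp_smul_le volume (continuous_classicalGrad (m := k) hw)
    (hasCompactSupport_classicalGrad b.hasCompactSupport)
  obtain ⟨δ, hδ, hδA⟩ := exists_le_luxemburg_comp_smul volume (continuous_classicalGrad (m := j) hw)
    (exists_classicalGrad_ne_zero hw b.hasCompactSupport hb0)
  rw [finrank_euclideanSpace_fin] at hW₀ hW₁ hδA
  refine ⟨b, W₀, W₁, δ, hw, hδ, fun A hA a ha => ⟨hW₀ A hA a ha, ?_, ?_⟩⟩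
  · rw [hA.luxemburg_classicalGrad_comp_smul hw ha, ENNReal.coe_mul]
    gcongr
    exact hW₁ A hA a ha
  · rw [hA.luxemburg_classicalGrad_comp_smul hw ha, ENNReal.coe_mul]
    gcongr
    exact hδA A hA a ha

theorem inverseCondition_of_plainInequality (hn : 1 ≤ n) (hjk : j < k)
    (hA : IsYoung A) (hB : IsYoung B) (hC : IsYoung C)
    (h : PlainInequality n j k A B C) : InverseCondition j k A B C := by
  obtain ⟨K, hK⟩ := h
  have : Nonempty (Fin n) := Fin.pos_iff_nonempty.1 hn
  obtain ⟨w, W₀, W₁, δ, hw, hδ, hwA⟩ := exists_contDiff_luxemburg_comp_smul_bounds (n := n) j k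
  have hk : (0 : ℝ) < k := by exact_mod_cast (by lia : 0 < k)
  have hθ' : 0 ≤ 1 - (j : ℝ) / k :=
    sub_nonneg.2 ((div_le_one hk).2 (by exact_mod_cast hjk.le))
  refine ⟨K * (W₁ ^ ((j : ℝ) / k) * W₀ ^ (1 - (j : ℝ) / k)) / δ, fun t ht => ?_⟩
  obtain ⟨a, ha, rfl⟩ : ∃ a : ℝ≥0, 0 < a ∧ a ^ n = t :=
    ⟨t ^ (n : ℝ)⁻¹, NNReal.rpow_pos ht, NNReal.rpow_inv_natCast_pow t (by lia)⟩
  have hu : ContDiff ℝ ∞ fun x => w ((a : ℝ) • x) := hw.comp (by fun_prop)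
  obtain ⟨hC₀, -, -⟩ := hwA C hC a ha
  obtain ⟨-, hBk, -⟩ := hwA B hB a ha
  obtain ⟨-, -, hAj⟩ := hwA A hA a ha
  have hineq := hK _ ⟨hu.continuous.locallyIntegrable, fun _ _ => ⟨_, hasWeakGrad_classicalGrad hu⟩⟩
    _ _ (hasWeakGrad_classicalGrad hu) (hasWeakGrad_classicalGrad hu)
    (Or.inr (ne_top_of_le_ne_top ENNReal.coe_ne_top hC₀))
  have hpow : (a ^ k) ^ ((j : ℝ) / k) = a ^ j := by
    rw [← NNReal.rpow_natCast_mul, mul_div_cancel₀ _ hk.ne', NNReal.rpow_natCast]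
  refine rpow_mul_rpow_le_of_dilation_le hδ (pow_pos ha k) (hB.inverse_pos ht) (hC.inverse_pos ht)
    (hA.inverse_pos ht) ?_
  rw [hpow]
  refine ENNReal.coe_le_coe.1 ((hAj.trans hineq).trans ?_)
  rw [ENNReal.coe_mul, ENNReal.coe_mul, ENNReal.coe_rpow_of_nonneg _ (by positivity),
    ENNReal.coe_rpow_of_nonneg _ hθ']
  gcongr

end Necessity

end GNOrlicz

end

theorem corollary1p4 (n j k : ℕ) (hn : 1 ≤ n) (hj : 1 ≤ j) (hjk : j < k)
    (A B C : ℝ≥0 → ℝ≥0) (hA : GNOrlicz.IsYoung A) (hB : GNOrlicz.IsYoung B)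
    (hC : GNOrlicz.IsYoung C) :
    (GNOrlicz.InverseCondition j k A B C → GNOrlicz.MaximalInequality n j k A B C) ∧
    (GNOrlicz.InverseCondition j k A B C →
      GNOrlicz.upperBoydIndex B < 1 → GNOrlicz.upperBoydIndex C < 1 →
      GNOrlicz.PlainInequality n j k A B C) ∧
    (¬ GNOrlicz.InverseCondition j k A B C → ¬ GNOrlicz.PlainInequality n j k A B C) :=
  ⟨GNOrlicz.maximalInequality_of_inverseCondition hn hj hjk hA hB hC,
    GNOrlicz.plainInequality_of_inverseCondition hn hj hjk hA hB hC,
    mt (GNOrlicz.inverseCondition_of_plainInequality hn hjk hA hB hC)⟩
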